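/- Let $n\ge 1$ be an integer and let $l\ge 0$ be real. For $f\in L^2(\mathbf R^n)$ (complex-valued) let $\hat f$ be its Fourier transform with the normalization $\hat f(\xi)=\int_{\mathbf R^n}e^{-ix\cdot\xi}f(x)\,dx$ (extended to $L^2$ by Plancherel), and put $$\|f\|_{H^s}=\Big(\int_{\mathbf R^n}(1+|\xi|^{2s})|\hat f(\xi)|^2\,d\xi\Big)^{1/2},\qquad \|f\|_{1,\gamma}=\int_{\mathbf R^n}(1+|x|)^\gamma|f(x)|\,dx .$$ Let $H^s=\{f\in L^2:\|f\|_{H^s}<\infty\}$ and $L^{1,\gamma}=\{f\in L^1:\|f\|_{1,\gamma}<\infty\}$, and put $$I(u_0,u_1)=\|u_0\|_{H^{l+1}}+\|u_1\|_{H^l}+\|u_0\|_{1,0}+\|u_1\|_{1,1}.$$ **Theorem 4.7.** There is a constant $C>0$, depending only on $n$ and $l$, with the following property. Let $u_0\in H^{l+1}(\mathbf R^n)\cap L^1(\mathbf R^n)$, $u_1\in H^l(\mathbf R^n)\cap L^{1,1}(\mathbf R^n)$, and let $u\in C([0,\infty);H^1(\mathbf R^n))\cap C^1([0,\infty);L^2(\mathbf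 R^n))$ be the mild solution of $$u_{tt}-\Delta u+\Delta^2u_t=0\quad\text{in }(0,\infty)\times\mathbf R^n,\qquad u(0)=u_0,\quad u_t(0)=u_1,$$ that is, $u(0)=u_0$, $u_t(0)=u_1$ and $\frac{d}{dt}\int u_t\varphi\,dx=\int u\,\Delta\varphi\,dx-\int u_t\,\Delta^2\varphi\,dx$ for all $t\ge0$ and all Schwartz functions $\varphi$ on $\mathbf R^n$. Then the following estimates hold for all $t\ge 1$, the norms being those of $L^2(\mathbf R^n_\xi)$. (i) $$\Big\|\hat u(t,\xi)-e^{-t/|\xi|^2}\widehat{u_0}(\xi)\Big\|_2\le\begin{cases}C\,I(u_0,u_1)\,t^{-\frac{l+4}{2}}, & 0\le l\le \frac n4-\frac92 \text{ with } n\ge18,\\[4pt] C\,I(u_0,u_1)\,t^{-\frac n8+\frac14}, & \frac n4-\frac92<l<\frac n4-\frac32\text{ with }n\ge18,\ \text{ or } 0\le l<\frac n4-\frac32\text{ with }7\le n\le17.\end{cases}$$ (ii) If $l=\frac n4-\frac32$ and $n\ge6$, then $$\Big\|\hat u(t,\xi)-\Big(\int_{\mathbf R^n}u_1(x)\,dx\Big)e^{-\frac12t|\xi|^4}\frac{\sin(t|\xi|)}{|\xi|}-e^{-t/|\xi|^2}\widehat{u_0}(\xi)\Big\|_2\le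 C\,I(u_0,u_1)\,t^{-\frac n8}.$$ (iii) $$\Big\|\hat u(t,\xi)-\Big(\int_{\mathbf R^n}u_1(x)\,dx\Big)e^{-\frac12t|\xi|^4}\frac{\sin(t|\xi|)}{|\xi|}\Big\|_2\le\begin{cases}C\,I(u_0,u_1)\,t^{-\frac{l+1}{2}}, & \frac n4-\frac32<l\le\frac n4-1\text{ with }n\ge6,\ \text{ or }0\le l\le\frac n4-1\text{ with }n=4,5,\\[4pt] C\,I(u_0,u_1)\,t^{-\frac n8}, & \frac n4-1<l\text{ with }n\ge4,\ \text{ or }0\le l\text{ with }n=1,2,3.\end{cases}$$ -/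

import Mathlib

open scoped FourierTransform SchwartzMap Laplacian ENNReal Topology
open MeasureTheory Filter

noncomputable section

namespace DampedWave

/-- Euclidean space `ℝⁿ`. -/
abbrev Rn (n : ℕ) : Type := EuclideanSpace ℝ (Fin n)

/-- The (complex) Lebesgue space `L²(ℝⁿ)`. -/
abbrev L2 (n : ℕ) : Type := Lp (α := Rn n) ℂ 2 volume

/-- The Fourier transform `f̂(ξ) = ∫ e^{-i x·ξ} f(x) dx` on `L²(ℝⁿ)`, in the sense of Plancherel.
Mathlib's `𝓕` is the `L²` extension of `(𝓕 f)(η) = ∫ e^{-2πi x·η} f(x) dx`, so that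
`f̂(ξ) = (𝓕 f)(ξ / 2π)`. -/
def hat {n : ℕ} (f : L2 n) (ξ : Rn n) : ℂ :=
  (𝓕 f : L2 n) ((2 * Real.pi)⁻¹ • ξ)

/-- On Schwartz functions `hat` is given by the Fourier integral. -/
theorem hat_toLp {n : ℕ} (f : 𝓢(Rn n, ℂ)) :
    ∀ᵐ ξ : Rn n, hat (f.toLp 2) ξ =
      ∫ x : Rn n, Complex.exp (-Complex.I * (inner ℝ x ξ : ℝ)) * f x := by
  have h : ∀ᵐ η : Rn n, (𝓕 (f.toLp 2) : L2 n) η = 𝓕 f η := by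
    rw [SchwartzMap.toLp_fourier_eq]
    exact SchwartzMap.coeFn_toLp (𝓕 f) 2
  have hπ : (2 * Real.pi)⁻¹ ≠ 0 := by positivity
  have hq : Measure.QuasiMeasurePreserving (fun ξ : Rn n => (2 * Real.pi)⁻¹ • ξ) volume volume := by
    refine ⟨measurable_const_smul _, ?_⟩
    rw [Measure.map_addHaar_smul volume hπ]
    exact Measure.smul_absolutelyContinuous
  filter_upwards [hq.ae h] with ξ hξ
  rw [hat, hξ, SchwartzMap.fourier_coe, Real.fourier_eq']
  refine integral_congr_ae (Filter.Eventually.of_forall fun x => ?_)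
  have hp : (Real.pi : ℂ) ≠ 0 := by exact_mod_cast Real.pi_ne_zero
  simp only [smul_eq_mul, inner_smul_right]
  congr 2
  push_cast
  field_simp

/-- Membership in the Sobolev space `H^s(ℝⁿ)`. -/
def MemH {n : ℕ} (s : ℝ) (f : L2 n) : Prop :=
  Integrable (fun ξ : Rn n => (1 + ‖ξ‖ ^ (2 * s)) * ‖hat f ξ‖ ^ 2)

/-- The norm `‖f‖_{H^s} = (∫ (1 + |ξ|^{2s}) |f̂(ξ)|² dξ)^{1/2}`. -/
def normH {n : ℕ} (s : ℝ) (f : L2 n) : ℝ :=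
  Real.sqrt (∫ ξ : Rn n, (1 + ‖ξ‖ ^ (2 * s)) * ‖hat f ξ‖ ^ 2)

/-- Membership in the weighted space `L^{1,γ}(ℝⁿ)`. -/
def MemL1 {n : ℕ} (γ : ℝ) (f : L2 n) : Prop :=
  Integrable (fun x : Rn n => f x) ∧ Integrable (fun x : Rn n => (1 + ‖x‖) ^ γ * ‖f x‖)

/-- The norm `‖f‖_{1,γ} = ∫ (1 + |x|)^γ |f(x)| dx`. -/
def normL1 {n : ℕ} (γ : ℝ) (f : L2 n) : ℝ :=
  ∫ x : Rn n, (1 + ‖x‖) ^ γ * ‖f x‖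

/-- `I^{l,γ}(u₀,u₁) = ‖u₀‖_{H^{l+1}} + ‖u₁‖_{H^l} + ‖u₀‖_{1,γ} + ‖u₁‖_{1,γ+1}`. -/
def dataNorm {n : ℕ} (l γ : ℝ) (u₀ u₁ : L2 n) : ℝ :=
  normH (l + 1) u₀ + normH l u₁ + normL1 γ u₀ + normL1 (γ + 1) u₁

/-- `u` is the solution of `u_tt - Δu + Δ²u_t = 0` on `(0,∞) × ℝⁿ` with `u(0) = u₀`,
`u_t(0) = u₁`, in the class `C([0,∞); H¹) ∩ C¹([0,∞); L²)`. The velocity is `v = u_t`, and the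
equation `v_t = Δu - Δ²v` is tested against Schwartz functions of the space variable, which is
the weak characterization of mild solutions. Only the values `u t` with `t ≥ 0` matter. -/
structure IsSolution {n : ℕ} (u₀ u₁ : L2 n) (u : ℝ → L2 n) : Prop where
  memH : ∀ t : ℝ, 0 ≤ t → MemH 1 (u t)
  continuousH : ∀ t : ℝ, 0 ≤ t →
    Tendsto (fun s => normH 1 (u s - u t)) (𝓝[Set.Ici 0] t) (𝓝 0)
  initial : u 0 = u₀
  exists_velocity : ∃ v : ℝ → L2 n,
    ContinuousOn v (Set.Ici 0) ∧
    (∀ t : ℝ, 0 ≤ t → HasDerivWithinAt u (v t) (Set.Ici 0) t) ∧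
    v 0 = u₁ ∧
    ∀ φ : 𝓢(Rn n, ℂ), ∀ t : ℝ, 0 ≤ t →
      HasDerivWithinAt (fun s : ℝ => ∫ x : Rn n, v s x * φ x)
        ((∫ x : Rn n, u t x * (Δ φ) x) - ∫ x : Rn n, v t x * (Δ (Δ φ)) x) (Set.Ici 0) t

/-- The regularity-loss profile `e^{-t/|ξ|²} û₀(ξ)`. -/
def regularityLossProfile {n : ℕ} (u₀ : L2 n) (t : ℝ) (ξ : Rn n) : ℂ :=
  (Real.exp (-(t / ‖ξ‖ ^ 2)) : ℂ) * hat u₀ ξ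

/-- The diffusion-wave profile `(∫ u₁) e^{-t|ξ|⁴/2} sin(t|ξ|)/|ξ|`. -/
def diffusionWaveProfile {n : ℕ} (u₁ : L2 n) (t : ℝ) (ξ : Rn n) : ℂ :=
  (∫ x : Rn n, u₁ x) * ((Real.exp (-(t * ‖ξ‖ ^ 4 / 2)) * (Real.sin (t * ‖ξ‖) / ‖ξ‖) : ℝ) : ℂ)

end DampedWave

end

open DampedWave

/-! On the Fourier side, with `r = |ξ|`, the equation becomes `w'' + r⁴ w' + r² w = 0`, so `û(t) =
kerPos · û₀ + kerVel · û₁`, where the two kernels are the fundamental solutions of this ODE. The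
characteristic roots are `-r⁴/2 ± √(r⁸/4 - r²)`, and everything follows from their behaviour at
small and large `r`.

For `r ≤ 1` the roots are complex and close to `-r⁴/2 ± i r`. Thus `kerVel` is the diffusion-wave
kernel up to `O(e^{-t r⁴/4})`, and replacing `û₁(ξ)` by `∫ u₁` costs a factor `|ξ|` that cancels the
singularity `1/r`. All errors are `O(e^{-t r⁴/4})`, of `L²` norm `O(t^{-n/8})`. For `r ≥ 2` the
roots are real and the slow one is close to `-1/r²`. Thus `kerPos` is `e^{-t/r²}` up to `r⁻³
e^{-t/(2r²)}`, while `kerVel` is `O(r⁻⁴ e^{-t/(2r²)})`. Decay in time is bought with derivatives of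
the data through `e^{-x} ≤ C x^{-m}`, which gives `t^{-(l+4)/2}`. The range `1 ≤ r ≤ 2` decays
exponentially.

Subtracting both profiles therefore leaves `t^{-n/8} + t^{-(l+4)/2}` (`exists_pointwise_expansion`).
The wave profile itself has size `t^{-n/8+1/4}` when `n ≥ 3`, and the regularity-loss profile
`t^{-(l+1)/2}`. Adding one of them back and comparing exponents gives every case.

The solution formula needs uniqueness for the weak equation (`hat_solution`). Testing with Fourier
transforms of functions supported in a ball makes `Δ` and `Δ²` bounded, and iterated integration in
time then forces the difference to vanish. -/

noncomputable section

namespace DampedWave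

/-! ### The undamped oscillator, for either sign of the stiffness -/

/-- The solution of `y'' = -d y` with `y 0 = 1`, `y' 0 = 0`. -/
def oscCos (d t : ℝ) : ℝ :=
  if 0 ≤ d then Real.cos (t * √d) else Real.cosh (t * √(-d))

/-- The solution of `y'' = -d y` with `y 0 = 0`, `y' 0 = 1`. -/
def oscSin (d t : ℝ) : ℝ :=
  if 0 ≤ d then t * Real.sinc (t * √d) else Real.sinh (t * √(-d)) / √(-d)

theorem oscSin_of_pos {d : ℝ} (hd : 0 < d) (t : ℝ) : oscSin d t = Real.sin (t * √d) / √d := by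
  have h : √d ≠ 0 := (Real.sqrt_pos.2 hd).ne'
  rw [oscSin, if_pos hd.le]
  rcases eq_or_ne t 0 with rfl | ht
  · simp
  · rw [Real.sinc_of_ne_zero (mul_ne_zero ht h)]
    field_simp

theorem oscCos_zero (d : ℝ) : oscCos d 0 = 1 := by
  simp [oscCos]

theorem oscSin_zero (d : ℝ) : oscSin d 0 = 0 := by
  simp [oscSin]

theorem hasDerivAt_oscSin (d t : ℝ) : HasDerivAt (oscSin d) (oscCos d t) t := by
  rcases lt_trichotomy d 0 with hd | rfl | hd
  · have h : √(-d) ≠ 0 := (Real.sqrt_pos.2 (by linarith)).ne'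
    have e : oscSin d = fun t => Real.sinh (t * √(-d)) / √(-d) := by
      ext t; rw [oscSin, if_neg hd.not_ge]
    rw [e, oscCos, if_neg hd.not_ge]
    refine (((hasDerivAt_id' t).mul_const (√(-d))).sinh.div_const (√(-d))).congr_deriv ?_
    field_simp
  · have e : oscSin 0 = id := by ext t; simp [oscSin]
    rw [e]
    simpa [oscCos] using hasDerivAt_id t
  · have h : √d ≠ 0 := (Real.sqrt_pos.2 hd).ne'
    have e : oscSin d = fun t => Real.sin (t * √d) / √d := by
      ext t; exact oscSin_of_pos hd t
    rw [e, oscCos, if_pos hd.le]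
    refine (((hasDerivAt_id' t).mul_const (√d)).sin.div_const (√d)).congr_deriv ?_
    field_simp

theorem hasDerivAt_oscCos (d t : ℝ) : HasDerivAt (oscCos d) (-d * oscSin d t) t := by
  rcases lt_trichotomy d 0 with hd | rfl | hd
  · have h : √(-d) ≠ 0 := (Real.sqrt_pos.2 (by linarith)).ne'
    have e : oscCos d = fun t => Real.cosh (t * √(-d)) := by
      ext t; rw [oscCos, if_neg hd.not_ge]
    rw [e, oscSin, if_neg hd.not_ge]
    refine ((hasDerivAt_id' t).mul_const (√(-d))).cosh.congr_deriv ?_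
    have h2 : √(-d) ^ 2 = -d := Real.sq_sqrt (by linarith)
    field_simp
    rw [h2]
    ring
  · have e : oscCos 0 = fun _ => 1 := by ext t; simp [oscCos]
    rw [e]
    simpa using hasDerivAt_const t (1 : ℝ)
  · have h : √d ≠ 0 := (Real.sqrt_pos.2 hd).ne'
    have e : oscCos d = fun t => Real.cos (t * √d) := by
      ext t; rw [oscCos, if_pos hd.le]
    rw [e, oscSin_of_pos hd]
    refine ((hasDerivAt_id' t).mul_const (√d)).cos.congr_deriv ?_
    have h2 : √d ^ 2 = d := Real.sq_sqrt hd.le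
    field_simp
    rw [h2]
    ring

theorem measurable_oscCos (t : ℝ) : Measurable fun d => oscCos d t :=
  Measurable.ite measurableSet_Ici (by fun_prop) (by fun_prop)

theorem measurable_oscSin (t : ℝ) : Measurable fun d => oscSin d t := by
  have h := Real.continuous_sinc.measurable
  exact Measurable.ite measurableSet_Ici (by fun_prop) (by fun_prop)

theorem abs_cosh_le_exp_abs (x : ℝ) : |Real.cosh x| ≤ Real.exp |x| := by
  rw [abs_of_pos (Real.cosh_pos x), ← Real.cosh_abs, Real.cosh_eq]
  have := Real.exp_le_exp.2 (neg_le_self (abs_nonneg x))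
  linarith

theorem abs_sinh_le_abs_mul_exp_abs (x : ℝ) : |Real.sinh x| ≤ |x| * Real.exp |x| := by
  rw [Real.abs_sinh, Real.sinh_eq]
  have h1 : Real.exp (-|x|) = Real.exp |x| * Real.exp (-(2 * |x|)) := by
    rw [← Real.exp_add]; ring_nf
  have h2 := Real.add_one_le_exp (-(2 * |x|))
  rw [h1]
  nlinarith [Real.exp_pos |x|]

/-- Here `s` is any upper bound for the exponential growth rate `√(-d)`. Leaving it free gives one
bound across the sign change of `d`, where the two roots collide. -/
theorem abs_oscCos_le {d s : ℝ} (hs : 0 ≤ s) (hd : -d ≤ s ^ 2) (t : ℝ) :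
    |oscCos d t| ≤ Real.exp (|t| * s) := by
  rw [oscCos]
  split_ifs with h
  · exact (Real.abs_cos_le_one _).trans (Real.one_le_exp (by positivity))
  · refine (abs_cosh_le_exp_abs _).trans (Real.exp_le_exp.2 ?_)
    rw [abs_mul, abs_of_nonneg (Real.sqrt_nonneg _)]
    gcongr
    simpa [Real.sqrt_sq hs] using Real.sqrt_le_sqrt hd

theorem abs_oscSin_le {d s : ℝ} (hs : 0 ≤ s) (hd : -d ≤ s ^ 2) (t : ℝ) :
    |oscSin d t| ≤ |t| * Real.exp (|t| * s) := by
  rw [oscSin]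
  split_ifs with h
  · rw [abs_mul]
    gcongr
    exact (Real.abs_sinc_le_one _).trans (Real.one_le_exp (by positivity))
  · have h0 : 0 < √(-d) := Real.sqrt_pos.2 (by linarith)
    have hsq : √(-d) ≤ s := by simpa [Real.sqrt_sq hs] using Real.sqrt_le_sqrt hd
    rw [abs_div, abs_of_pos h0, div_le_iff₀ h0]
    refine (abs_sinh_le_abs_mul_exp_abs _).trans ?_
    rw [abs_mul, abs_of_pos h0]
    calc |t| * √(-d) * Real.exp (|t| * √(-d)) ≤ |t| * √(-d) * Real.exp (|t| * s) := by gcongr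
      _ = _ := by ring

/-! ### The Fourier kernels and their local bounds -/

/-- The discriminant of `λ² + r⁴ λ + r² = 0`, up to the factor `-4`. -/
def disc (r : ℝ) : ℝ := r ^ 2 - r ^ 8 / 4

/-- The solution of `w'' + r⁴ w' + r² w = 0` with `w 0 = 1`, `w' 0 = 0`. -/
def kerPos (t r : ℝ) : ℝ :=
  Real.exp (-(r ^ 4 * t / 2)) * (oscCos (disc r) t + r ^ 4 / 2 * oscSin (disc r) t)

/-- The solution of `w'' + r⁴ w' + r² w = 0` with `w 0 = 0`, `w' 0 = 1`. -/
def kerVel (t r : ℝ) : ℝ :=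
  Real.exp (-(r ^ 4 * t / 2)) * oscSin (disc r) t

/-- The time derivative of `kerVel`. -/
def kerVelDeriv (t r : ℝ) : ℝ :=
  Real.exp (-(r ^ 4 * t / 2)) * (oscCos (disc r) t - r ^ 4 / 2 * oscSin (disc r) t)

theorem hasDerivAt_exp_damping (t r : ℝ) :
    HasDerivAt (fun t => Real.exp (-(r ^ 4 * t / 2)))
      (Real.exp (-(r ^ 4 * t / 2)) * -(r ^ 4 / 2)) t := by
  have h : HasDerivAt (fun t : ℝ => -(r ^ 4 * t / 2)) (-(r ^ 4 / 2)) t := by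
    simpa using (((hasDerivAt_id' t).const_mul (r ^ 4)).div_const 2).fun_neg
  exact h.exp

theorem hasDerivAt_kerPos (t r : ℝ) :
    HasDerivAt (fun t => kerPos t r) (-(r ^ 2 * kerVel t r)) t := by
  refine HasDerivAt.congr_deriv ((hasDerivAt_exp_damping t r).mul
    ((hasDerivAt_oscCos (disc r) t).add ((hasDerivAt_oscSin (disc r) t).const_mul (r ^ 4 / 2)))) ?_
  simp only [kerVel, disc]
  ring

theorem hasDerivAt_kerVel (t r : ℝ) :
    HasDerivAt (fun t => kerVel t r) (kerVelDeriv t r) t := by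
  refine HasDerivAt.congr_deriv ((hasDerivAt_exp_damping t r).mul (hasDerivAt_oscSin (disc r) t)) ?_
  simp only [kerVelDeriv]
  ring

theorem hasDerivAt_kerVelDeriv (t r : ℝ) :
    HasDerivAt (fun t => kerVelDeriv t r) (-(r ^ 4 * kerVelDeriv t r) - r ^ 2 * kerVel t r) t := by
  refine HasDerivAt.congr_deriv ((hasDerivAt_exp_damping t r).mul
    ((hasDerivAt_oscCos (disc r) t).sub ((hasDerivAt_oscSin (disc r) t).const_mul (r ^ 4 / 2)))) ?_
  simp only [kerVel, kerVelDeriv, disc]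
  ring

theorem kerPos_zero (r : ℝ) : kerPos 0 r = 1 := by
  simp [kerPos, oscCos_zero, oscSin_zero]

theorem kerVel_zero (r : ℝ) : kerVel 0 r = 0 := by
  simp [kerVel, oscSin_zero]

theorem kerVelDeriv_zero (r : ℝ) : kerVelDeriv 0 r = 1 := by
  simp [kerVelDeriv, oscCos_zero, oscSin_zero]

theorem measurable_disc : Measurable disc := by
  unfold disc; fun_prop

theorem measurable_kerPos (t : ℝ) : Measurable (kerPos t) := by
  have h1 := (measurable_oscCos t).comp measurable_disc
  have h2 := (measurable_oscSin t).comp measurable_disc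
  simp only [Function.comp_def] at h1 h2
  unfold kerPos
  fun_prop

theorem measurable_kerVel (t : ℝ) : Measurable (kerVel t) := by
  have h2 := (measurable_oscSin t).comp measurable_disc
  simp only [Function.comp_def] at h2
  unfold kerVel
  fun_prop

theorem measurable_kerVelDeriv (t : ℝ) : Measurable (kerVelDeriv t) := by
  have h1 := (measurable_oscCos t).comp measurable_disc
  have h2 := (measurable_oscSin t).comp measurable_disc
  simp only [Function.comp_def] at h1 h2
  unfold kerVelDeriv
  fun_prop

theorem neg_disc_le (r : ℝ) : -disc r ≤ (r ^ 4 / 2) ^ 2 := by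
  rw [disc]; nlinarith [sq_nonneg r]

theorem abs_exp_mul_oscCos_le (t r : ℝ) :
    |Real.exp (-(r ^ 4 * t / 2)) * oscCos (disc r) t| ≤ Real.exp (r ^ 4 * |t|) := by
  rw [abs_mul, Real.abs_exp]
  calc _ ≤ Real.exp (r ^ 4 * |t| / 2) * Real.exp (|t| * (r ^ 4 / 2)) := by
        gcongr
        · have := neg_abs_le t
          have : 0 ≤ r ^ 4 := by positivity
          nlinarith
        · exact abs_oscCos_le (by positivity) (neg_disc_le r) t
    _ = _ := by rw [← Real.exp_add]; ring_nf

theorem abs_exp_mul_oscSin_le (t r : ℝ) :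
    |Real.exp (-(r ^ 4 * t / 2)) * oscSin (disc r) t| ≤ |t| * Real.exp (r ^ 4 * |t|) := by
  rw [abs_mul, Real.abs_exp]
  calc _ ≤ Real.exp (r ^ 4 * |t| / 2) * (|t| * Real.exp (|t| * (r ^ 4 / 2))) := by
        gcongr
        · have := neg_abs_le t
          have : 0 ≤ r ^ 4 := by positivity
          nlinarith
        · exact abs_oscSin_le (by positivity) (neg_disc_le r) t
    _ = |t| * (Real.exp (r ^ 4 * |t| / 2) * Real.exp (|t| * (r ^ 4 / 2))) := by ring
    _ = _ := by rw [← Real.exp_add]; ring_nf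

/-- A common bound for the kernels on bounded sets. -/
theorem abs_kernel_le {t r T R : ℝ} (ht : |t| ≤ T) (hr : 0 ≤ r) (hrR : r ≤ R) :
    |kerPos t r| ≤ (1 + T) * (1 + R ^ 4) * Real.exp (R ^ 4 * T) ∧
    |kerVel t r| ≤ (1 + T) * (1 + R ^ 4) * Real.exp (R ^ 4 * T) ∧
    |kerVelDeriv t r| ≤ (1 + T) * (1 + R ^ 4) * Real.exp (R ^ 4 * T) := by
  have hT : 0 ≤ T := (abs_nonneg t).trans ht
  have hr4 : r ^ 4 ≤ R ^ 4 := by gcongr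
  have hr0 : 0 ≤ r ^ 4 := by positivity
  have hE : Real.exp (r ^ 4 * |t|) ≤ Real.exp (R ^ 4 * T) :=
    Real.exp_le_exp.2 (by gcongr)
  have hc := (abs_exp_mul_oscCos_le t r).trans hE
  have hs : |Real.exp (-(r ^ 4 * t / 2)) * oscSin (disc r) t| ≤ T * Real.exp (R ^ 4 * T) :=
    (abs_exp_mul_oscSin_le t r).trans (by gcongr)
  have hp := Real.exp_pos (R ^ 4 * T)
  have hrs : |r ^ 4 / 2 * (Real.exp (-(r ^ 4 * t / 2)) * oscSin (disc r) t)|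
      ≤ R ^ 4 * (T * Real.exp (R ^ 4 * T)) := by
    rw [abs_mul, abs_of_nonneg (by positivity)]
    gcongr
    linarith
  have key : Real.exp (R ^ 4 * T) + R ^ 4 * (T * Real.exp (R ^ 4 * T)) ≤
      (1 + T) * (1 + R ^ 4) * Real.exp (R ^ 4 * T) := by
    have h1 : 0 ≤ T * Real.exp (R ^ 4 * T) := by positivity
    have h2 : 0 ≤ R ^ 4 * Real.exp (R ^ 4 * T) := by positivity
    nlinarith
  refine ⟨?_, ?_, ?_⟩
  · rw [kerPos, mul_add, mul_left_comm]
    exact (abs_add_le _ _).trans ((add_le_add hc hrs).trans key)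
  · rw [kerVel]
    refine hs.trans ?_
    have h1 : 0 ≤ T * R ^ 4 * Real.exp (R ^ 4 * T) := by positivity
    have h2 : 0 ≤ R ^ 4 * Real.exp (R ^ 4 * T) := by positivity
    nlinarith
  · rw [kerVelDeriv, mul_sub, mul_left_comm]
    exact (abs_sub _ _).trans ((add_le_add hc hrs).trans key)

/-! ### Kernel asymptotics at low, middle and high frequency -/

/-- The diffusion-wave kernel `e^{-tr⁴/2} sin(tr)/r`. -/
def waveKer (t r : ℝ) : ℝ := Real.exp (-(t * r ^ 4 / 2)) * (Real.sin (t * r) / r)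

/-- The last bound is the difference of squares `r² - disc r = r⁸/4` divided by `r + √(disc r) ≥ r`.
-/
theorem disc_low {r : ℝ} (hr : 0 < r) (hr1 : r ≤ 1) :
    0 < disc r ∧ r / 2 ≤ √(disc r) ∧ √(disc r) ≤ r ∧ r - √(disc r) ≤ r ^ 7 / 4 := by
  have h8 : r ^ 8 ≤ r ^ 2 := pow_le_pow_of_le_one hr.le hr1 (by norm_num)
  have h2 : 0 < r ^ 2 := by positivity
  have hd : 0 < disc r := by rw [disc]; linarith
  have ha : r / 2 ≤ √(disc r) := Real.le_sqrt_of_sq_le (by rw [disc]; nlinarith)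
  have hb : √(disc r) ≤ r := by
    rw [Real.sqrt_le_left hr.le, disc]
    have : 0 ≤ r ^ 8 := by positivity
    linarith
  refine ⟨hd, ha, hb, ?_⟩
  have hs : √(disc r) ^ 2 = disc r := Real.sq_sqrt hd.le
  have hprod : (r - √(disc r)) * (r + √(disc r)) = r ^ 8 / 4 := by
    calc _ = r ^ 2 - √(disc r) ^ 2 := by ring
      _ = _ := by rw [hs, disc]; ring
  have : (r - √(disc r)) * r ≤ r ^ 7 / 4 * r := by
    calc _ ≤ (r - √(disc r)) * (r + √(disc r)) := by
          apply mul_le_mul_of_nonneg_left _ (sub_nonneg.2 hb)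
          linarith [Real.sqrt_nonneg (disc r)]
      _ = _ := by rw [hprod]; ring
  exact le_of_mul_le_mul_right this hr

theorem mul_exp_neg_le_one (x : ℝ) : x * Real.exp (-x) ≤ 1 := by
  have h := Real.add_one_le_exp x
  rw [Real.exp_neg, ← div_eq_mul_inv, div_le_one (Real.exp_pos x)]
  linarith

theorem abs_kerPos_low {t r : ℝ} (ht : 0 ≤ t) (hr : 0 < r) (hr1 : r ≤ 1) :
    |kerPos t r| ≤ 2 * Real.exp (-(t * r ^ 4 / 4)) := by
  obtain ⟨hd, ha, -, -⟩ := disc_low hr hr1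
  have ha0 : 0 < √(disc r) := Real.sqrt_pos.2 hd
  have hr4 : r ^ 4 ≤ r := by simpa using pow_le_pow_of_le_one hr.le hr1 (show 1 ≤ 4 by norm_num)
  rw [kerPos, abs_mul, Real.abs_exp, oscSin_of_pos hd, oscCos, if_pos hd.le, mul_comm]
  have h1 : |r ^ 4 / 2 * (Real.sin (t * √(disc r)) / √(disc r))| ≤ 1 := by
    rw [abs_mul, abs_div _ (√(disc r)), abs_of_pos ha0, abs_of_nonneg (by positivity)]
    calc _ ≤ r / 2 * (1 / √(disc r)) := by
          gcongr
          exact Real.abs_sin_le_one _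
      _ ≤ 1 := by rw [mul_one_div, div_le_one ha0]; exact ha
  refine mul_le_mul ?_ (Real.exp_le_exp.2 ?_) (Real.exp_pos _).le (by norm_num)
  · calc _ ≤ _ := abs_add_le _ _
      _ ≤ 1 + 1 := add_le_add (Real.abs_cos_le_one _) h1
      _ = 2 := by norm_num
  · have : 0 ≤ t * r ^ 4 := by positivity
    linarith

/-- Replacing `√(disc r)` by `r` shifts the phase by `O(t r⁷)` and changes the reciprocal by
`O(r⁵)`. After division by the frequency the first error is `O(t r⁴)`, which half of the damping
absorbs. -/
theorem abs_kerVel_sub_waveKer_low {t r : ℝ} (ht : 0 ≤ t) (hr : 0 < r) (hr1 : r ≤ 1) :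
    |kerVel t r - waveKer t r| ≤ 3 * Real.exp (-(t * r ^ 4 / 4)) := by
  obtain ⟨hd, ha, hb, hab⟩ := disc_low hr hr1
  set a := √(disc r) with hadef
  have ha0 : 0 < a := Real.sqrt_pos.2 hd
  have e1 : kerVel t r - waveKer t r =
      Real.exp (-(t * r ^ 4 / 2)) * (Real.sin (t * a) / a - Real.sin (t * r) / r) := by
    rw [kerVel, waveKer, oscSin_of_pos hd, mul_sub, mul_comm (r ^ 4) t]
  have hr5 : r ^ 5 ≤ 1 := pow_le_one₀ hr.le hr1
  have hr64 : r ^ 6 ≤ r ^ 4 := pow_le_pow_of_le_one hr.le hr1 (by norm_num)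
  have hr0 : 0 ≤ r - a := sub_nonneg.2 hb
  have h1 : |Real.sin (t * a) - Real.sin (t * r)| ≤ t * (r ^ 7 / 4) := by
    have := Real.abs_sin_sub_sin_le (t * a) (t * r)
    refine this.trans ?_
    rw [← mul_sub, abs_mul, abs_of_nonneg ht, abs_sub_comm, abs_of_nonneg hr0]
    gcongr
  have h2 : |Real.sin (t * a) / a - Real.sin (t * r) / r| ≤ t * r ^ 4 / 2 + 1 / 2 := by
    have e2 : Real.sin (t * a) / a - Real.sin (t * r) / r =
        (Real.sin (t * a) - Real.sin (t * r)) / a + Real.sin (t * r) * ((r - a) / (a * r)) := by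
      field_simp
      ring
    rw [e2]
    refine (abs_add_le _ _).trans (add_le_add ?_ ?_)
    · rw [abs_div, abs_of_pos ha0, div_le_iff₀ ha0]
      calc _ ≤ t * (r ^ 7 / 4) := h1
        _ = t * r ^ 6 / 2 * (r / 2) := by ring
        _ ≤ t * r ^ 4 / 2 * a := by gcongr
    · rw [abs_mul, abs_of_nonneg (div_nonneg hr0 (by positivity))]
      calc _ ≤ 1 * ((r ^ 7 / 4) / (r / 2 * r)) := by
            gcongr
            exact Real.abs_sin_le_one _
        _ = r ^ 5 / 2 := by field_simp; ring
        _ ≤ 1 / 2 := by linarith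
  rw [e1, abs_mul, Real.abs_exp]
  have h3 := mul_exp_neg_le_one (t * r ^ 4 / 4)
  -- One factor is kept for the final bound, the other absorbs the growth `t r⁴ / 2`.
  have h4 : Real.exp (-(t * r ^ 4 / 2)) =
      Real.exp (-(t * r ^ 4 / 4)) * Real.exp (-(t * r ^ 4 / 4)) := by
    rw [← Real.exp_add]; ring_nf
  have h5 : Real.exp (-(t * r ^ 4 / 4)) ≤ 1 := by
    rw [Real.exp_le_one_iff]
    have : 0 ≤ t * r ^ 4 := by positivity
    linarith
  have hp := Real.exp_pos (-(t * r ^ 4 / 4))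
  rw [h4, mul_assoc, mul_comm (3 : ℝ)]
  gcongr
  calc _ ≤ Real.exp (-(t * r ^ 4 / 4)) * (t * r ^ 4 / 2 + 1 / 2) := by gcongr
    _ = 2 * (t * r ^ 4 / 4 * Real.exp (-(t * r ^ 4 / 4))) + Real.exp (-(t * r ^ 4 / 4)) / 2 := by
        ring
    _ ≤ 3 := by linarith

/-- The discriminant vanishes at `r⁶ = 4`, so neither regime is uniform here. The growth rate is at
most `r⁴/2 - 1/4` because `r² ≤ 4`, and the damping `r⁴/2` then leaves `e^{-t/4}`; the double root
costs only a factor linear in `t`. -/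
theorem abs_ker_mid {t r : ℝ} (ht : 0 ≤ t) (hr1 : 1 ≤ r) (hr2 : r ≤ 2) :
    |kerPos t r| ≤ (1 + 8 * t) * Real.exp (-(t / 4)) ∧
    |kerVel t r| ≤ (1 + 8 * t) * Real.exp (-(t / 4)) := by
  have hr4 : 1 ≤ r ^ 4 := one_le_pow₀ hr1
  have hr16 : r ^ 4 ≤ 16 := by
    calc r ^ 4 ≤ 2 ^ 4 := by gcongr
      _ = 16 := by norm_num
  have hs : 0 ≤ r ^ 4 / 2 - 1 / 4 := by linarith
  have hd : -disc r ≤ (r ^ 4 / 2 - 1 / 4) ^ 2 := by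
    rw [disc]
    have : r ^ 2 ≤ 4 := by nlinarith
    nlinarith [sq_nonneg r]
  have hc := abs_oscCos_le hs hd t
  have hsn := abs_oscSin_le hs hd t
  rw [abs_of_nonneg ht] at hc hsn
  have hE : Real.exp (-(r ^ 4 * t / 2)) * Real.exp (t * (r ^ 4 / 2 - 1 / 4)) =
      Real.exp (-(t / 4)) := by
    rw [← Real.exp_add]; ring_nf
  have hc' : |Real.exp (-(r ^ 4 * t / 2)) * oscCos (disc r) t| ≤ Real.exp (-(t / 4)) := by
    rw [abs_mul, Real.abs_exp, ← hE]; gcongr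
  have hs' : |Real.exp (-(r ^ 4 * t / 2)) * oscSin (disc r) t| ≤ t * Real.exp (-(t / 4)) := by
    rw [abs_mul, Real.abs_exp, ← hE, mul_left_comm]; gcongr
  have hp : 0 ≤ t * Real.exp (-(t / 4)) := by positivity
  constructor
  · rw [kerPos, mul_add, mul_left_comm]
    refine (abs_add_le _ _).trans ?_
    rw [abs_mul (r ^ 4 / 2), abs_of_nonneg (by positivity : 0 ≤ r ^ 4 / 2)]
    calc _ ≤ Real.exp (-(t / 4)) + 16 / 2 * (t * Real.exp (-(t / 4))) := by gcongr
      _ = _ := by ring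
  · rw [kerVel]
    refine hs'.trans ?_
    nlinarith [Real.exp_pos (-(t / 4))]

/-- Both roots are real, `-m` and `-(r⁴/2 + s)`, with product `r²`. Hence `m` is about `1/r²`, with
`m - 1/r² = m²/r⁴ ≤ 4/r⁸`, and the fast exponential enters `kerPos` only with the small weight
`m/s`. -/
theorem ker_high {t r : ℝ} (ht : 0 ≤ t) (hr2 : 2 ≤ r) :
    |kerPos t r - Real.exp (-(t / r ^ 2))| ≤ 2 / r ^ 3 * Real.exp (-(t / (2 * r ^ 2))) ∧
    |kerVel t r| ≤ 2 / r ^ 4 * Real.exp (-(t / (2 * r ^ 2))) := by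
  have hr : 0 < r := by linarith
  have h6 : 64 ≤ r ^ 6 := by
    calc (64 : ℝ) = 2 ^ 6 := by norm_num
      _ ≤ r ^ 6 := by gcongr
  have h3 : 8 ≤ r ^ 3 := by
    calc (8 : ℝ) = 2 ^ 3 := by norm_num
      _ ≤ r ^ 3 := by gcongr
  have h2 : 0 < r ^ 2 := by positivity
  have hd8 : r ^ 8 = r ^ 2 * r ^ 6 := by ring
  have hd : disc r < 0 := by rw [disc, hd8]; nlinarith
  obtain ⟨s, hs, hs2⟩ : ∃ s, s = √(-disc r) ∧ s ^ 2 = r ^ 8 / 4 - r ^ 2 :=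
    ⟨_, rfl, by rw [Real.sq_sqrt (by linarith), disc]; ring⟩
  have hs4 : r ^ 4 / 4 ≤ s := by
    rw [hs]; refine Real.le_sqrt_of_sq_le ?_
    rw [disc, hd8]
    nlinarith [show (r ^ 4 / 4) ^ 2 = r ^ 2 * r ^ 6 / 16 by ring]
  have hs0 : 0 < s := lt_of_lt_of_le (by positivity) hs4
  have hsu : s < r ^ 4 / 2 := by
    refine lt_of_pow_lt_pow_left₀ 2 (by positivity) ?_
    rw [hs2]; nlinarith [show (r ^ 4 / 2) ^ 2 = r ^ 8 / 4 by ring]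
  obtain ⟨m, hm⟩ : ∃ m, m = r ^ 4 / 2 - s := ⟨_, rfl⟩
  have hm0 : 0 < m := by linarith
  have hmeq : m * (r ^ 4 / 2 + s) = r ^ 2 := by
    rw [hm]; calc _ = r ^ 8 / 4 - s ^ 2 := by ring
      _ = _ := by rw [hs2]; ring
  have hmu : m ≤ 2 / r ^ 2 := by
    rw [le_div_iff₀ h2]
    have : m * (r ^ 4 / 2) ≤ r ^ 2 := by nlinarith
    have : m * r ^ 2 * (r ^ 2) ≤ 2 * r ^ 2 := by nlinarith [show m * r ^ 2 * r ^ 2 = m * r ^ 4 by ring]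
    exact le_of_mul_le_mul_right this h2
  have hml : m - 1 / r ^ 2 = m ^ 2 / r ^ 4 := by
    have : m * r ^ 4 = m ^ 2 + r ^ 2 := by rw [← hmeq, hm]; ring
    field_simp
    nlinarith
  have hml0 : 0 ≤ m - 1 / r ^ 2 := by rw [hml]; positivity
  obtain ⟨G, hG⟩ : ∃ G, G = Real.exp (-(t / r ^ 2)) := ⟨_, rfl⟩
  obtain ⟨H, hH⟩ : ∃ H, H = Real.exp (-(t / (2 * r ^ 2))) := ⟨_, rfl⟩
  have hG0 : 0 < G := hG ▸ Real.exp_pos _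
  have hH0 : 0 < H := hH ▸ Real.exp_pos _
  have hGH : G ≤ H := by
    rw [hG, hH]; gcongr; linarith
  obtain ⟨A, hA⟩ : ∃ A, A = Real.exp (-(t * m)) := ⟨_, rfl⟩
  obtain ⟨B, hB⟩ : ∃ B, B = Real.exp (-(t * (r ^ 4 / 2 + s))) := ⟨_, rfl⟩
  have hB0 : 0 < B := hB ▸ Real.exp_pos _
  have hBA : B ≤ A := by
    rw [hA, hB]; gcongr; linarith
  have hAG : A ≤ G := by
    rw [hA, hG, Real.exp_le_exp, neg_le_neg_iff, div_eq_mul_one_div]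
    gcongr; linarith
  have hGA : G - A ≤ 1 / r ^ 3 * H := by
    have e1 : A = G * Real.exp (-(t * (m - 1 / r ^ 2))) := by
      rw [hA, hG, ← Real.exp_add]; ring_nf
    -- The factor `t` in the error is absorbed by one copy of `H`; the other copy survives in the
    -- bound.
    have e2 : G = H * H := by
      rw [hG, hH, ← Real.exp_add]; congr 1; field_simp; ring
    have e3 := Real.add_one_le_exp (-(t * (m - 1 / r ^ 2)))
    have e4 : G - A ≤ G * (t * (m - 1 / r ^ 2)) := by rw [e1]; nlinarith
    have e5 : m - 1 / r ^ 2 ≤ 4 / r ^ 8 := by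
      rw [hml]
      calc m ^ 2 / r ^ 4 ≤ (2 / r ^ 2) ^ 2 / r ^ 4 := by gcongr
        _ = 4 / r ^ 8 := by field_simp; norm_num
    have e6 := mul_exp_neg_le_one (t / (2 * r ^ 2))
    rw [← hH] at e6
    calc G - A ≤ G * (t * (4 / r ^ 8)) := e4.trans (by gcongr)
      _ = H * (8 / (r ^ 3 * r ^ 3)) * (t / (2 * r ^ 2) * H) := by rw [e2]; field_simp; ring
      _ ≤ H * (8 / (r ^ 3 * 8)) * 1 := by gcongr
      _ = _ := by field_simp
  have hcos : Real.exp (-(r ^ 4 * t / 2)) * oscCos (disc r) t = (A + B) / 2 := by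
    rw [oscCos, if_neg hd.not_ge, ← hs, Real.cosh_eq, hA, hB, hm, mul_div_assoc', mul_add,
      ← Real.exp_add, ← Real.exp_add]
    ring_nf
  have hsin : Real.exp (-(r ^ 4 * t / 2)) * oscSin (disc r) t = (A - B) / (2 * s) := by
    rw [oscSin, if_neg hd.not_ge, ← hs, Real.sinh_eq, hA, hB, hm, mul_div_assoc', mul_div_assoc',
      mul_sub, ← Real.exp_add, ← Real.exp_add, div_div]
    ring_nf
  rw [← hG, ← hH]
  constructor
  · have e1 : kerPos t r - G = -(G - A) + m / s * ((A - B) / 2) := by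
      rw [kerPos, mul_add, mul_left_comm, hcos, hsin, hm]
      field_simp
      ring
    have e2 : m / s ≤ 1 / r ^ 3 := by
      calc m / s ≤ (2 / r ^ 2) / (r ^ 4 / 4) := by gcongr
        _ = 8 / (r ^ 3 * r ^ 3) := by field_simp; norm_num
        _ ≤ 8 / (8 * r ^ 3) := by gcongr
        _ = _ := by field_simp
    rw [e1]
    refine (abs_add_le _ _).trans ?_
    rw [abs_neg, abs_of_nonneg (by linarith), abs_of_nonneg (by
      have := sub_nonneg.2 hBA; positivity)]
    calc _ ≤ 1 / r ^ 3 * H + 1 / r ^ 3 * H := by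
          gcongr
          linarith
      _ = _ := by ring
  · rw [kerVel, hsin, abs_of_nonneg (div_nonneg (by linarith) (by linarith))]
    calc (A - B) / (2 * s) ≤ H / (2 * (r ^ 4 / 4)) := by
          gcongr
          linarith
      _ = _ := by field_simp; norm_num

/-! ### Trading derivatives for decay in time -/

/-- This is `x/m ≤ e^{x/m}` raised to the power `m`. With `x` proportional to `t/r²` it yields
`t^{-m} r^{2m}`, the mechanism of regularity loss. -/
theorem exp_neg_le_rpow {m x : ℝ} (hm : 0 < m) (hx : 0 < x) :
    Real.exp (-x) ≤ m ^ m * x ^ (-m) := by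
  have h1 : x / m ≤ Real.exp (x / m) := by linarith [Real.add_one_le_exp (x / m)]
  have h2 : (x / m) ^ m ≤ Real.exp x := by
    calc (x / m) ^ m ≤ (Real.exp (x / m)) ^ m := by gcongr
      _ = Real.exp x := by rw [← Real.exp_mul]; field_simp
  rw [Real.div_rpow hx.le hm.le, div_le_iff₀ (by positivity)] at h2
  rw [Real.exp_neg, Real.rpow_neg hx.le, inv_le_iff_one_le_mul₀ (Real.exp_pos x)]
  have h3 : 0 < x ^ m := by positivity
  have h4 : 1 ≤ (x ^ m)⁻¹ * (Real.exp x * m ^ m) := by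
    rw [inv_mul_eq_div, one_le_div h3]; exact h2
  linarith

/-- Regularity-loss decay of the kernels at frequencies `r ≥ 1`. -/
theorem exists_ker_decay {l : ℝ} (hl : 0 ≤ l) :
    ∃ C : ℝ, 0 < C ∧ ∀ t r : ℝ, 1 ≤ t → 1 ≤ r →
      |kerPos t r - Real.exp (-(t / r ^ 2))| ≤ C * t ^ (-((l + 4) / 2)) * r ^ (l + 1) ∧
      |kerVel t r| ≤ C * t ^ (-((l + 4) / 2)) * r ^ l := by
  obtain ⟨m, hm⟩ : ∃ m, m = (l + 4) / 2 := ⟨_, rfl⟩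
  have hm0 : 0 < m := by rw [hm]; linarith
  have hC1 : (0:ℝ) < 2 * m ^ m * 2 ^ m := by positivity
  have hC2 : (0:ℝ) < 66 * m ^ m * 8 ^ m := by positivity
  refine ⟨2 * m ^ m * 2 ^ m + 66 * m ^ m * 8 ^ m, by positivity, fun t r ht hr => ?_⟩
  rw [← hm]
  have ht0 : 0 < t := by linarith
  have hr0 : 0 < r := by linarith
  have htm : 0 < t ^ (-m) := by positivity
  have hrl : 1 ≤ r ^ l := Real.one_le_rpow hr hl
  have hrl1 : 1 ≤ r ^ (l + 1) := Real.one_le_rpow hr (by linarith)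
  rcases le_total r 2 with h | h
  · obtain ⟨h1, h2⟩ := abs_ker_mid ht0.le hr h
    have h3 : Real.exp (-(t / r ^ 2)) ≤ Real.exp (-(t / 4)) := by
      gcongr
      nlinarith
    -- Half of the exponential absorbs the linear factor: `8t = 64 · (t/8)` and `x e^{-x} ≤ 1` give
    -- `2 + 64 = 66`.
    have h4 : (2 + 8 * t) * Real.exp (-(t / 4)) ≤ 66 * Real.exp (-(t / 8)) := by
      have e1 := mul_exp_neg_le_one (t / 8)
      have e2 : Real.exp (-(t / 4)) = Real.exp (-(t / 8)) * Real.exp (-(t / 8)) := by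
        rw [← Real.exp_add]; ring_nf
      have e3 : Real.exp (-(t / 8)) ≤ 1 := by rw [Real.exp_le_one_iff]; linarith
      have e4 := Real.exp_pos (-(t / 8))
      rw [e2]
      nlinarith
    have h5 : 66 * Real.exp (-(t / 8)) ≤ 66 * m ^ m * 8 ^ m * t ^ (-m) := by
      have := exp_neg_le_rpow hm0 (show 0 < t / 8 by positivity)
      rw [Real.div_rpow ht0.le (by norm_num), Real.rpow_neg (by norm_num : (0:ℝ) ≤ 8),
        div_inv_eq_mul] at this
      linarith
    have h6 : (2 + 8 * t) * Real.exp (-(t / 4)) ≤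
        (2 * m ^ m * 2 ^ m + 66 * m ^ m * 8 ^ m) * t ^ (-m) := by
      refine (h4.trans h5).trans ?_
      gcongr
      linarith
    have h7 : 0 ≤ (2 * m ^ m * 2 ^ m + 66 * m ^ m * 8 ^ m) * t ^ (-m) := by positivity
    constructor
    · calc _ ≤ |kerPos t r| + |Real.exp (-(t / r ^ 2))| := abs_sub _ _
        _ ≤ (1 + 8 * t) * Real.exp (-(t / 4)) + Real.exp (-(t / 4)) := by
            rw [Real.abs_exp]; gcongr
        _ ≤ (2 * m ^ m * 2 ^ m + 66 * m ^ m * 8 ^ m) * t ^ (-m) := by linarith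
        _ ≤ _ := le_mul_of_one_le_right h7 hrl1
    · calc _ ≤ (1 + 8 * t) * Real.exp (-(t / 4)) := h2
        _ ≤ (2 * m ^ m * 2 ^ m + 66 * m ^ m * 8 ^ m) * t ^ (-m) := by
            linarith [Real.exp_pos (-(t / 4))]
        _ ≤ _ := le_mul_of_one_le_right h7 hrl
  · obtain ⟨h1, h2⟩ := ker_high ht0.le h
    have h3 : Real.exp (-(t / (2 * r ^ 2))) ≤ m ^ m * 2 ^ m * t ^ (-m) * r ^ (l + 4) := by
      have := exp_neg_le_rpow hm0 (show 0 < t / (2 * r ^ 2) by positivity)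
      rw [Real.div_rpow ht0.le (by positivity), Real.rpow_neg (by positivity : 0 ≤ 2 * r ^ 2),
        div_inv_eq_mul, Real.mul_rpow (by norm_num) (by positivity), ← Real.rpow_natCast r 2,
        ← Real.rpow_mul hr0.le] at this
      have e : ((2 : ℕ) : ℝ) * m = l + 4 := by rw [hm]; push_cast; ring
      rw [e, Real.rpow_natCast] at this
      linarith
    -- The exponent `m = (l + 4)/2` costs `r^(l+4)`. The gains `r⁻³` and `r⁻⁴` of the kernels reduce
    -- this to exactly the available regularity, `l + 1` for `u₀` and `l` for `u₁`.
    have e3 : r ^ (l + 4) / r ^ 3 = r ^ (l + 1) := by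
      rw [← Real.rpow_natCast r 3, ← Real.rpow_sub hr0]; congr 1; push_cast; ring
    have e4 : r ^ (l + 4) / r ^ 4 = r ^ l := by
      rw [← Real.rpow_natCast r 4, ← Real.rpow_sub hr0]; congr 1; push_cast; ring
    constructor
    · calc _ ≤ _ := h1
        _ ≤ 2 / r ^ 3 * (m ^ m * 2 ^ m * t ^ (-m) * r ^ (l + 4)) := by gcongr
        _ = 2 * m ^ m * 2 ^ m * t ^ (-m) * r ^ (l + 1) := by rw [← e3]; ring
        _ ≤ _ := by gcongr; linarith
    · calc _ ≤ _ := h2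
        _ ≤ 2 / r ^ 4 * (m ^ m * 2 ^ m * t ^ (-m) * r ^ (l + 4)) := by gcongr
        _ = 2 * m ^ m * 2 ^ m * t ^ (-m) * r ^ l := by rw [← e4]; ring
        _ ≤ _ := by gcongr; linarith

/-! ### Fourier transform of the Laplacian and pairings in `L²` -/

variable {n : ℕ}

/-- The frequency variable `|ξ|` corresponding to `ξ = 2π η`. -/
def rad (η : Rn n) : ℝ := 2 * Real.pi * ‖η‖

theorem rad_nonneg (η : Rn n) : 0 ≤ rad η := by unfold rad; positivity

theorem measurable_rad : Measurable (rad : Rn n → ℝ) := by unfold rad; fun_prop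

/-- Multiplication of a Schwartz function by `|ξ|² = (2π |η|)²`. -/
def mulSq (ψ : 𝓢(Rn n, ℂ)) : 𝓢(Rn n, ℂ) :=
  (2 * Real.pi) ^ 2 • SchwartzMap.smulLeftCLM ℂ (‖·‖ ^ 2 : Rn n → ℝ) ψ

theorem mulSq_apply (ψ : 𝓢(Rn n, ℂ)) (x : Rn n) : mulSq ψ x = ((rad x ^ 2 : ℝ) : ℂ) * ψ x := by
  have h : Function.HasTemperateGrowth (‖·‖ ^ 2 : Rn n → ℝ) := by fun_prop
  rw [mulSq, smul_apply, SchwartzMap.smulLeftCLM_apply_apply h, smul_smul,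
    Complex.real_smul]
  simp [rad, mul_pow]

theorem fourierInv_apply_neg (f : 𝓢(Rn n, ℂ)) (x : Rn n) : (𝓕⁻ f) x = (𝓕 f) (-x) := by
  rw [SchwartzMap.fourierInv_coe, SchwartzMap.fourier_coe, Real.fourierInv_eq_fourier_neg]

theorem laplacian_fourier (ψ : 𝓢(Rn n, ℂ)) : Δ (𝓕 ψ) = -𝓕 (mulSq ψ) := by
  have h : Function.HasTemperateGrowth (‖·‖ ^ 2 : Rn n → ℝ) := by fun_prop
  -- The multiplier formula for `Δ` has the transforms in the opposite order. Exchanging `𝓕` and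
  -- `𝓕⁻` costs a reflection, harmless because the symbol is even.
  have key : 𝓕⁻ (Δ (𝓕 ψ)) = -mulSq ψ := by
    ext x
    rw [SchwartzMap.laplacian_eq_fourierMultiplierCLM, SchwartzMap.fourierMultiplierCLM_apply,
      fourierInv_apply_neg, FourierTransform.fourier_smul, FourierTransform.fourier_fourierInv_eq,
      smul_apply, SchwartzMap.smulLeftCLM_apply_apply h, ← fourierInv_apply_neg,
      FourierTransform.fourierInv_fourier_eq, mulSq, neg_apply, smul_apply,
      SchwartzMap.smulLeftCLM_apply_apply h]
    simp
  have := congrArg (fun φ => 𝓕 φ) key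
  simp only [FourierTransform.fourier_fourierInv_eq] at this
  rw [this, FourierTransform.fourier_neg]

theorem integral_fourier_mul (f : L2 n) (ψ : 𝓢(Rn n, ℂ)) :
    ∫ x, (𝓕 f : L2 n) x * ψ x = ∫ x, f x * (𝓕 ψ) x := by
  have h := congrArg (fun T => T ψ) (Lp.fourier_toTemperedDistribution_eq f)
  simp only [TemperedDistribution.fourier_apply, Lp.toTemperedDistribution_apply,
    smul_eq_mul] at h
  simp_rw [mul_comm _ (ψ _), mul_comm _ ((𝓕 ψ) _)]
  exact h.symm

/-- Continuity of the moment as a functional on `L²` lets the strong derivative `u' = v` pass to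
moments. -/
theorem exists_pairing (ψ : 𝓢(Rn n, ℂ)) :
    ∃ L : L2 n →L[ℂ] ℂ, ∀ f : L2 n, L f = ∫ x, (𝓕 f : L2 n) x * ψ x := by
  have : ENNReal.HolderConjugate 2 2 := inferInstance
  refine ⟨((ContinuousLinearMap.mul ℂ ℂ).lpPairing volume 2 2).flip (ψ.toLp 2) ∘L
    FourierTransform.fourierCLM ℂ (L2 n), fun f => ?_⟩
  simp only [ContinuousLinearMap.comp_apply, ContinuousLinearMap.flip_apply,
    ContinuousLinearMap.lpPairing_eq_integral, ContinuousLinearMap.mul_apply']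
  refine integral_congr_ae ?_
  filter_upwards [ψ.coeFn_toLp 2] with x hx
  rw [hx]
  rfl

theorem integrable_sq_norm (f : L2 n) : Integrable fun x => ‖f x‖ ^ 2 :=
  (memLp_two_iff_integrable_sq_norm (Lp.aestronglyMeasurable f)).1 (Lp.memLp f)

theorem eLpNorm_two_eq {α E : Type*} [MeasurableSpace α] [NormedAddCommGroup E] {μ : Measure α}
    {f : α → E} (hf : AEStronglyMeasurable f μ) (hf2 : Integrable (fun x => ‖f x‖ ^ 2) μ) :
    eLpNorm f 2 μ = ENNReal.ofReal (√(∫ x, ‖f x‖ ^ 2 ∂μ)) := by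
  rw [MemLp.eLpNorm_eq_integral_rpow_norm two_ne_zero ENNReal.ofNat_ne_top
    ((memLp_two_iff_integrable_sq_norm hf).2 hf2), Real.sqrt_eq_rpow]
  simp

theorem integral_sq_norm (f : L2 n) : ∫ x, ‖f x‖ ^ 2 = ‖f‖ ^ 2 := by
  rw [Lp.norm_def, eLpNorm_two_eq (Lp.aestronglyMeasurable f) (integrable_sq_norm f),
    ENNReal.toReal_ofReal (Real.sqrt_nonneg _), Real.sq_sqrt (integral_nonneg fun x => by positivity)]

/-- Testing against functions supported in a ball. -/
theorem norm_integral_mul_le (g : L2 n) {h ψ : Rn n → ℂ} {R A B : ℝ} (hA : 0 ≤ A) (hB : 0 ≤ B)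
    (hh : ∀ x, rad x ≤ R → ‖h x‖ ≤ A * ‖g x‖) (hψ : ∀ x, R < rad x → ψ x = 0)
    (hψB : ∀ x, ‖ψ x‖ ≤ B) :
    ‖∫ x, h x * ψ x‖ ≤ A * (volume.real {x : Rn n | rad x ≤ R} + ‖g‖ ^ 2) * B := by
  have hball : {x : Rn n | rad x ≤ R} = Metric.closedBall 0 (R / (2 * Real.pi)) := by
    ext x
    rw [Set.mem_ofPred_eq, mem_closedBall_zero_iff, le_div_iff₀ (by positivity), rad, mul_comm]
  have hm : MeasurableSet {x : Rn n | rad x ≤ R} := hball ▸ Metric.isClosed_closedBall.measurableSet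
  have hfin : volume {x : Rn n | rad x ≤ R} ≠ ∞ := hball ▸ measure_closedBall_lt_top.ne
  have hi : Integrable ({x : Rn n | rad x ≤ R}.indicator fun _ => (1 : ℝ)) :=
    (integrable_indicator_iff hm).2 (integrableOn_const hfin)
  have := norm_integral_le_of_norm_le (f := fun x => h x * ψ x)
    (((hi.add (integrable_sq_norm g)).const_mul A).mul_const B)
    (Eventually.of_forall fun x => ?_)
  · refine this.trans_eq ?_
    rw [integral_mul_const, integral_const_mul]
    simp only [Pi.add_apply]
    rw [integral_add hi (integrable_sq_norm g), integral_sq_norm, integral_indicator_const _ hm]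
    simp
  · rw [norm_mul]
    rcases le_or_gt (rad x) R with hx | hx
    · refine mul_le_mul ?_ (hψB x) (norm_nonneg _) ?_
      · exact (hh x hx).trans (by
          rw [Pi.add_apply, Set.indicator_of_mem (show x ∈ {x : Rn n | rad x ≤ R} from hx)]
          gcongr
          -- The elementary bound `‖g‖ ≤ 1 + ‖g‖²` replaces Cauchy–Schwarz on the ball; the size of
          -- the constant is irrelevant later.
          nlinarith [sq_nonneg (‖g x‖ - 1)])
      · have : 0 ≤ {x : Rn n | rad x ≤ R}.indicator (fun _ => (1 : ℝ)) x :=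
          Set.indicator_nonneg (fun _ _ => zero_le_one) x
        simp only [Pi.add_apply]
        positivity
    · rw [hψ x hx]
      simp only [norm_zero, mul_zero, Pi.add_apply]
      have : 0 ≤ {x : Rn n | rad x ≤ R}.indicator (fun _ => (1 : ℝ)) x :=
        Set.indicator_nonneg (fun _ _ => zero_le_one) x
      positivity

/-! ### Moments of multiplier kernels and their time derivatives -/

theorem integrable_mul_schwartz (g : L2 n) (ψ : 𝓢(Rn n, ℂ)) :
    Integrable fun x => g x * ψ x :=
  (Lp.memLp g).integrable_mul (SchwartzMap.memLp ψ 2)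

theorem aestronglyMeasurable_kernel_mul {k : ℝ → ℝ} (hk : Measurable k) (g : L2 n)
    (ψ : 𝓢(Rn n, ℂ)) :
    AEStronglyMeasurable (fun x : Rn n => (k (rad x) : ℂ) * g x * ψ x) :=
  (((Complex.measurable_ofReal.comp (hk.comp measurable_rad)).aestronglyMeasurable).mul
    (Lp.aestronglyMeasurable g)).mul ψ.continuous.aestronglyMeasurable

theorem norm_kernel_mul_le {k : ℝ → ℝ} {A R : ℝ} (hk : ∀ r, 0 ≤ r → r ≤ R → |k r| ≤ A) (g : L2 n)
    {ψ : 𝓢(Rn n, ℂ)} (hψ : ∀ x, R < rad x → ψ x = 0) (x : Rn n) :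
    ‖(k (rad x) : ℂ) * g x * ψ x‖ ≤ A * ‖g x * ψ x‖ := by
  rcases le_or_gt (rad x) R with hx | hx
  · rw [mul_assoc, norm_mul, Complex.norm_real, Real.norm_eq_abs]
    gcongr
    exact hk _ (rad_nonneg x) hx
  · simp [hψ x hx]

theorem integrable_kernel_mul {k : ℝ → ℝ} (hm : Measurable k) {A R : ℝ}
    (hk : ∀ r, 0 ≤ r → r ≤ R → |k r| ≤ A) (g : L2 n) {ψ : 𝓢(Rn n, ℂ)}
    (hψ : ∀ x, R < rad x → ψ x = 0) :
    Integrable (fun x => (k (rad x) : ℂ) * g x * ψ x) :=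
  ((integrable_mul_schwartz g ψ).norm.const_mul A).mono' (aestronglyMeasurable_kernel_mul hm g ψ)
    (Eventually.of_forall (norm_kernel_mul_le hk g hψ))

/-- Differentiation in time of a multiplier kernel tested against a compactly supported
function. -/
theorem hasDerivAt_integral_kernel {κ κ' : ℝ → ℝ → ℝ}
    (hd : ∀ t r, HasDerivAt (fun t => κ t r) (κ' t r) t)
    (hm : ∀ t, Measurable (κ t)) (hm' : ∀ t, Measurable (κ' t))
    (hb : ∀ T R : ℝ, ∃ A, ∀ t r, |t| ≤ T → 0 ≤ r → r ≤ R → |κ t r| ≤ A ∧ |κ' t r| ≤ A)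
    (g : L2 n) (ψ : 𝓢(Rn n, ℂ)) {R : ℝ} (hψ : ∀ x, R < rad x → ψ x = 0) (t : ℝ) :
    HasDerivAt (fun t => ∫ x, (κ t (rad x) : ℂ) * g x * ψ x)
      (∫ x, (κ' t (rad x) : ℂ) * g x * ψ x) t := by
  obtain ⟨A, hA⟩ := hb (|t| + 1) R
  refine (hasDerivAt_integral_of_dominated_loc_of_deriv_le
    (F' := fun t x => (κ' t (rad x) : ℂ) * g x * ψ x) (s := Metric.ball t 1)
    (Metric.ball_mem_nhds t one_pos)
    (Eventually.of_forall fun s => aestronglyMeasurable_kernel_mul (hm s) g ψ)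
    (integrable_kernel_mul (hm t) (fun r h0 h1 => (hA t r (by linarith) h0 h1).1) g hψ)
    (aestronglyMeasurable_kernel_mul (hm' t) g ψ) (Eventually.of_forall fun x s hs => ?_)
    ((integrable_mul_schwartz g ψ).norm.const_mul A) (Eventually.of_forall fun x s _ => ?_)).2
  · refine norm_kernel_mul_le (fun r h0 h1 => (hA s r ?_ h0 h1).2) g hψ x
    rw [Metric.mem_ball, Real.dist_eq] at hs
    have := abs_add_le t (s - t)
    rw [add_sub_cancel] at this
    linarith
  · exact (((hd s (rad x)).ofReal_comp).mul_const (g x)).mul_const (ψ x)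

/-! ### Uniqueness and the solution formula -/

/-- Uniqueness for a family of moments satisfying a second order system. -/
theorem moment_eq_zero {Ψ : Type*} (S : Ψ → Ψ) (N : Ψ → ℝ → Prop) {K M T : ℝ} (hK : 0 ≤ K)
    (hM : 0 ≤ M) (hN : ∀ ψ B, N ψ B → N (S ψ) (K * B)) (hN0 : ∀ ψ B, N ψ B → 0 ≤ B)
    (D E : Ψ → ℝ → ℂ)
    (hD : ∀ ψ, ∀ t, 0 ≤ t → HasDerivWithinAt (D ψ) (E ψ t) (Set.Ici 0) t)
    (hE : ∀ ψ, ∀ t, 0 ≤ t →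
      HasDerivWithinAt (E ψ) (-D (S ψ) t - E (S (S ψ)) t) (Set.Ici 0) t)
    (hD0 : ∀ ψ, D ψ 0 = 0) (hE0 : ∀ ψ, E ψ 0 = 0)
    (hbd : ∀ ψ B, N ψ B → ∀ t ∈ Set.Icc 0 T, ‖D ψ t‖ ≤ M * B ∧ ‖E ψ t‖ ≤ M * B)
    {ψ : Ψ} {B : ℝ} (hψ : N ψ B) (hT : 0 ≤ T) : D ψ T = 0 := by
  -- The derivative of `D` costs a factor `1`, that of `E` a factor `K + K²` from `S ψ` and `S (S
  -- ψ)`; `Q` dominates both.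
  set Q := 1 + K + K ^ 2 with hQ
  have hQ1 : 1 ≤ Q := by rw [hQ]; nlinarith [sq_nonneg K]
  -- Picard iteration: each integration in time improves the bound by one term of the exponential
  -- series. The induction runs over all `ψ` at once because the system couples `ψ` to `S ψ` and `S
  -- (S ψ)`.
  have key : ∀ k : ℕ, ∀ ψ B, N ψ B → ∀ t ∈ Set.Icc 0 T,
      ‖D ψ t‖ ≤ M * B * ((Q * t) ^ k / k.factorial) ∧
      ‖E ψ t‖ ≤ M * B * ((Q * t) ^ k / k.factorial) := by
    intro k
    induction k with
    | zero => intro ψ B h t ht; simpa using hbd ψ B h t ht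
    | succ k ih =>
      intro ψ B h t ht
      have hB := hN0 ψ B h
      have hbder : ∀ s : ℝ, HasDerivAt
          (fun s : ℝ => M * B * ((Q * s) ^ (k + 1) / (k + 1).factorial))
          (Q * (M * B * ((Q * s) ^ k / k.factorial))) s := fun s => by
        refine ((((hasDerivAt_id' s).const_mul Q).pow (k + 1)).div_const
          ((k + 1).factorial : ℝ)).const_mul (M * B) |>.congr_deriv ?_
        rw [Nat.factorial_succ]
        push_cast
        have : (k.factorial : ℝ) ≠ 0 := by positivity
        field_simp
      have hrest : ∀ F : ℝ → ℂ, ∀ F' : ℝ → ℂ, F 0 = 0 →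
          (∀ s, 0 ≤ s → HasDerivWithinAt F (F' s) (Set.Ici 0) s) →
          (∀ s ∈ Set.Ico 0 T, ‖F' s‖ ≤ Q * (M * B * ((Q * s) ^ k / k.factorial))) →
          ‖F t‖ ≤ M * B * ((Q * t) ^ (k + 1) / (k + 1).factorial) := by
        intro F F' h0 hF hF'
        refine image_norm_le_of_norm_deriv_right_le_deriv_boundary (f := F) (f' := F')
          (fun s hs => ((hF s hs.1).continuousWithinAt).mono Set.Icc_subset_Ici_self)
          (fun s hs => (hF s hs.1).mono (Set.Ici_subset_Ici.2 hs.1)) ?_ hbder hF' ht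
        simp [h0]
      constructor
      · refine hrest _ _ (hD0 ψ) (hD ψ) fun s hs => ?_
        have h1 := (ih ψ B h s ⟨hs.1, hs.2.le⟩).2
        have hs0 := hs.1
        exact h1.trans (le_mul_of_one_le_left (by positivity) hQ1)
      · refine hrest _ _ (hE0 ψ) (hE ψ) fun s hs => ?_
        have h1 := (ih _ _ (hN ψ B h) s ⟨hs.1, hs.2.le⟩).1
        have h2 := (ih _ _ (hN _ _ (hN ψ B h)) s ⟨hs.1, hs.2.le⟩).2
        have hs0 := hs.1
        have hp : 0 ≤ M * B * ((Q * s) ^ k / k.factorial) := by positivity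
        calc _ ≤ ‖D (S ψ) s‖ + ‖E (S (S ψ)) s‖ := by
              refine (norm_sub_le _ _).trans ?_
              rw [norm_neg]
          _ ≤ (K + K ^ 2) * (M * B * ((Q * s) ^ k / k.factorial)) := by linarith
          _ ≤ _ := by gcongr; linarith
  have hlim : Tendsto (fun k : ℕ => M * B * ((Q * T) ^ k / k.factorial)) atTop (𝓝 0) := by
    simpa using (FloorSemiring.tendsto_pow_div_factorial_atTop (Q * T)).const_mul (M * B)
  have := ge_of_tendsto' hlim fun k => (key k ψ B hψ T ⟨hT, le_rfl⟩).1
  exact norm_le_zero_iff.1 this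

/-- Schwartz functions supported in `{|ξ| ≤ R}`. -/
abbrev BandLimited (n : ℕ) (R : ℝ) : Type :=
  {ψ : 𝓢(Rn n, ℂ) // ∀ x, R < rad x → ψ x = 0}

/-- These are the kernels that occur as moments or as their time derivatives; the bound supplies
domination for differentiating under the integral and the a priori bound for uniqueness. -/
theorem exists_bound_ker (T R : ℝ) : ∃ A : ℝ, 0 ≤ A ∧ ∀ t r, |t| ≤ T → 0 ≤ r → r ≤ R →
    |kerPos t r| ≤ A ∧ |kerVel t r| ≤ A ∧ |kerVelDeriv t r| ≤ A ∧
    |-(r ^ 2 * kerVel t r)| ≤ A ∧ |-(r ^ 2 * kerVelDeriv t r)| ≤ A ∧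
    |-(r ^ 4 * kerVelDeriv t r) - r ^ 2 * kerVel t r| ≤ A := by
  obtain ⟨A, hA⟩ : ∃ A, A = |(1 + T) * (1 + R ^ 4) * Real.exp (R ^ 4 * T)| := ⟨_, rfl⟩
  have hA0 : 0 ≤ A := hA ▸ abs_nonneg _
  refine ⟨(1 + R ^ 2 + R ^ 4) * A, by positivity, fun t r ht h0 hR => ?_⟩
  obtain ⟨h1, h2, h3⟩ := abs_kernel_le ht h0 hR
  replace h1 := (h1.trans (le_abs_self _)).trans_eq hA.symm
  replace h2 := (h2.trans (le_abs_self _)).trans_eq hA.symm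
  replace h3 := (h3.trans (le_abs_self _)).trans_eq hA.symm
  have hr2 : r ^ 2 ≤ R ^ 2 := by gcongr
  have hr4 : r ^ 4 ≤ R ^ 4 := by gcongr
  have p2 : 0 ≤ R ^ 2 * A := by positivity
  have p4 : 0 ≤ R ^ 4 * A := by positivity
  have m2 : |r ^ 2 * kerVel t r| ≤ R ^ 2 * A := by
    rw [abs_mul, abs_of_nonneg (by positivity)]; gcongr
  have m2' : |r ^ 2 * kerVelDeriv t r| ≤ R ^ 2 * A := by
    rw [abs_mul, abs_of_nonneg (by positivity)]; gcongr
  have m4 : |r ^ 4 * kerVelDeriv t r| ≤ R ^ 4 * A := by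
    rw [abs_mul, abs_of_nonneg (by positivity)]; gcongr
  refine ⟨by linarith, by linarith, by linarith, ?_, ?_, ?_⟩
  · rw [abs_neg]; linarith
  · rw [abs_neg]; linarith
  · refine (abs_sub _ _).trans ?_
    rw [abs_neg]; linarith

/-- The moment of a multiplier kernel applied to `g`. -/
def kerMoment (κ : ℝ → ℝ → ℝ) (g : L2 n) (ψ : 𝓢(Rn n, ℂ)) (t : ℝ) : ℂ :=
  ∫ x, (κ t (rad x) : ℂ) * g x * ψ x

theorem kerMoment_zero (κ : ℝ → ℝ → ℝ) (g : L2 n) (ψ : 𝓢(Rn n, ℂ)) {c : ℝ}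
    (h : ∀ r, κ 0 r = c) : kerMoment κ g ψ 0 = c * ∫ x, g x * ψ x := by
  simp only [kerMoment, h, mul_assoc]
  exact integral_const_mul _ _

section moments

variable (g : L2 n) {R : ℝ} (ψ : BandLimited n R) (t : ℝ)

theorem hasDerivAt_moment_kerPos :
    HasDerivAt (kerMoment kerPos g ψ.1) (kerMoment (fun t r => -(r ^ 2 * kerVel t r)) g ψ.1 t) t :=
  (hasDerivAt_integral_kernel (κ' := fun t r => -(r ^ 2 * kerVel t r)) hasDerivAt_kerPos
    measurable_kerPos (fun t => by have := measurable_kerVel t; fun_prop)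
    (fun T R => let ⟨A, _, hA⟩ := exists_bound_ker T R
      ⟨A, fun t r h1 h2 h3 => ⟨(hA t r h1 h2 h3).1, (hA t r h1 h2 h3).2.2.2.1⟩⟩) g ψ.1 ψ.2 t)

theorem hasDerivAt_moment_kerVel :
    HasDerivAt (kerMoment kerVel g ψ.1) (kerMoment kerVelDeriv g ψ.1 t) t :=
  hasDerivAt_integral_kernel (κ' := kerVelDeriv) hasDerivAt_kerVel
    measurable_kerVel measurable_kerVelDeriv
    (fun T R => let ⟨A, _, hA⟩ := exists_bound_ker T R
      ⟨A, fun t r h1 h2 h3 => ⟨(hA t r h1 h2 h3).2.1, (hA t r h1 h2 h3).2.2.1⟩⟩) g ψ.1 ψ.2 t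

theorem hasDerivAt_moment_kerVelDeriv :
    HasDerivAt (kerMoment kerVelDeriv g ψ.1)
      (kerMoment (fun t r => -(r ^ 4 * kerVelDeriv t r) - r ^ 2 * kerVel t r) g ψ.1 t) t :=
  (hasDerivAt_integral_kernel
    (κ' := fun t r => -(r ^ 4 * kerVelDeriv t r) - r ^ 2 * kerVel t r) hasDerivAt_kerVelDeriv
    measurable_kerVelDeriv
    (fun t => by have := measurable_kerVel t; have := measurable_kerVelDeriv t; fun_prop)
    (fun T R => let ⟨A, _, hA⟩ := exists_bound_ker T R
      ⟨A, fun t r h1 h2 h3 => ⟨(hA t r h1 h2 h3).2.2.1, (hA t r h1 h2 h3).2.2.2.2.2⟩⟩) g ψ.1 ψ.2 t)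

theorem hasDerivAt_moment_neg_sq_kerVel :
    HasDerivAt (kerMoment (fun t r => -(r ^ 2 * kerVel t r)) g ψ.1)
      (kerMoment (fun t r => -(r ^ 2 * kerVelDeriv t r)) g ψ.1 t) t :=
  (hasDerivAt_integral_kernel (κ := fun t r => -(r ^ 2 * kerVel t r))
    (κ' := fun t r => -(r ^ 2 * kerVelDeriv t r))
    (fun t r => ((hasDerivAt_kerVel t r).const_mul (r ^ 2)).neg)
    (fun t => by have := measurable_kerVel t; fun_prop)
    (fun t => by have := measurable_kerVelDeriv t; fun_prop)
    (fun T R => let ⟨A, _, hA⟩ := exists_bound_ker T R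
      ⟨A, fun t r h1 h2 h3 => ⟨(hA t r h1 h2 h3).2.2.2.1, (hA t r h1 h2 h3).2.2.2.2.1⟩⟩)
      g ψ.1 ψ.2 t)

end moments

/-- Multiplication by `|ξ|²` on band-limited functions. -/
def BandLimited.mulSq {R : ℝ} (ψ : BandLimited n R) : BandLimited n R :=
  ⟨DampedWave.mulSq ψ.1, fun x hx => by rw [mulSq_apply, ψ.2 x hx, mul_zero]⟩

/-- The displacement moment of the difference between `u` and the explicit solution. -/
def posMoment (u₀ u₁ : L2 n) (u : ℝ → L2 n) (ψ : 𝓢(Rn n, ℂ)) (t : ℝ) : ℂ :=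
  (∫ x, (𝓕 (u t) : L2 n) x * ψ x) - kerMoment kerPos (𝓕 u₀) ψ t - kerMoment kerVel (𝓕 u₁) ψ t

/-- The velocity moment of the difference between `u` and the explicit solution. -/
def velMoment (u₀ u₁ : L2 n) (v : ℝ → L2 n) (ψ : 𝓢(Rn n, ℂ)) (t : ℝ) : ℂ :=
  (∫ x, (𝓕 (v t) : L2 n) x * ψ x) - kerMoment (fun t r => -(r ^ 2 * kerVel t r)) (𝓕 u₀) ψ t
    - kerMoment kerVelDeriv (𝓕 u₁) ψ t

/-- The weak equation is tested with `φ = 𝓕 ψ`; moving `𝓕` onto the solution turns `Δ` into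
multiplication by `-|ξ|²`. -/
theorem hasDerivWithinAt_fourier_velocity {u v : ℝ → L2 n} {t : ℝ}
    (h : ∀ φ : 𝓢(Rn n, ℂ),
      HasDerivWithinAt (fun s : ℝ => ∫ x : Rn n, v s x * φ x)
        ((∫ x : Rn n, u t x * (Δ φ) x) - ∫ x : Rn n, v t x * (Δ (Δ φ)) x) (Set.Ici 0) t)
    (ψ : 𝓢(Rn n, ℂ)) :
    HasDerivWithinAt (fun s : ℝ => ∫ x, (𝓕 (v s) : L2 n) x * ψ x)
      (-(∫ x, (𝓕 (u t) : L2 n) x * mulSq ψ x) - ∫ x, (𝓕 (v t) : L2 n) x * mulSq (mulSq ψ) x)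
      (Set.Ici 0) t := by
  have h1 : Δ (Δ (𝓕 ψ)) = 𝓕 (mulSq (mulSq ψ)) := by
    have hneg : -𝓕 (mulSq ψ) = 𝓕 (-mulSq ψ) := (FourierTransform.fourier_neg _).symm
    have hm : mulSq (-mulSq ψ) = -mulSq (mulSq ψ) := by
      ext x; simp [mulSq_apply]
    rw [laplacian_fourier, hneg, laplacian_fourier, hm, FourierTransform.fourier_neg, neg_neg]
  have h2 := h (𝓕 ψ)
  rw [h1, laplacian_fourier] at h2
  simp only [integral_fourier_mul]
  refine h2.congr_deriv ?_
  congr 1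
  rw [← integral_neg]
  simp

theorem hasDerivWithinAt_posMoment {u₀ u₁ : L2 n} {u v : ℝ → L2 n} {R t : ℝ}
    (h : HasDerivWithinAt u (v t) (Set.Ici 0) t) (ψ : BandLimited n R) :
    HasDerivWithinAt (posMoment u₀ u₁ u ψ.1) (velMoment u₀ u₁ v ψ.1 t) (Set.Ici 0) t := by
  obtain ⟨L, hL⟩ := exists_pairing ψ.1
  have h1 : HasDerivWithinAt (fun s => ∫ x, (𝓕 (u s) : L2 n) x * ψ.1 x)
      (∫ x, (𝓕 (v t) : L2 n) x * ψ.1 x) (Set.Ici 0) t := by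
    simp only [← hL]
    exact ((L.restrictScalars ℝ).hasFDerivAt.comp_hasDerivWithinAt t h)
  exact (h1.sub (hasDerivAt_moment_kerPos _ ψ t).hasDerivWithinAt).sub
    (hasDerivAt_moment_kerVel _ ψ t).hasDerivWithinAt

theorem hasDerivWithinAt_velMoment {u₀ u₁ : L2 n} {u v : ℝ → L2 n} {R t : ℝ}
    (h : ∀ φ : 𝓢(Rn n, ℂ),
      HasDerivWithinAt (fun s : ℝ => ∫ x : Rn n, v s x * φ x)
        ((∫ x : Rn n, u t x * (Δ φ) x) - ∫ x : Rn n, v t x * (Δ (Δ φ)) x) (Set.Ici 0) t)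
    (ψ : BandLimited n R) :
    HasDerivWithinAt (velMoment u₀ u₁ v ψ.1)
      (-posMoment u₀ u₁ u ψ.mulSq.1 t - velMoment u₀ u₁ v ψ.mulSq.mulSq.1 t) (Set.Ici 0) t := by
  refine HasDerivWithinAt.congr_deriv
    (((hasDerivWithinAt_fourier_velocity h ψ.1).sub
      (hasDerivAt_moment_neg_sq_kerVel _ ψ t).hasDerivWithinAt).sub
      (hasDerivAt_moment_kerVelDeriv _ ψ t).hasDerivWithinAt) ?_
  obtain ⟨A, -, hA⟩ := exists_bound_ker |t| R
  have i1 := integrable_kernel_mul (measurable_kerPos t)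
    (fun r h0 h1 => (hA t r le_rfl h0 h1).1) (𝓕 u₀ : L2 n) ψ.mulSq.2
  have i2 := integrable_kernel_mul (k := fun r => -(r ^ 2 * kerVel t r))
    (by have := measurable_kerVel t; fun_prop)
    (fun r h0 h1 => (hA t r le_rfl h0 h1).2.2.2.1) (𝓕 u₀ : L2 n) ψ.mulSq.mulSq.2
  have i3 := integrable_kernel_mul (measurable_kerVel t)
    (fun r h0 h1 => (hA t r le_rfl h0 h1).2.1) (𝓕 u₁ : L2 n) ψ.mulSq.2
  have i4 := integrable_kernel_mul (measurable_kerVelDeriv t)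
    (fun r h0 h1 => (hA t r le_rfl h0 h1).2.2.1) (𝓕 u₁ : L2 n) ψ.mulSq.mulSq.2
  -- Since `kerPos' = -r² kerVel`, this is the ODE for `kerPos`, in the form `kerVelDeriv = kerPos -
  -- r⁴ kerVel` multiplied by `r²`. The identity `e2` is the ODE for `kerVel`.
  have e1 : -kerMoment (fun t r => -(r ^ 2 * kerVelDeriv t r)) (𝓕 u₀) ψ.1 t =
      kerMoment kerPos (𝓕 u₀) ψ.mulSq.1 t +
      kerMoment (fun t r => -(r ^ 2 * kerVel t r)) (𝓕 u₀) ψ.mulSq.mulSq.1 t := by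
    simp only [kerMoment]
    rw [← integral_add i1 i2, ← integral_neg]
    refine integral_congr_ae (Eventually.of_forall fun x => ?_)
    simp only [BandLimited.mulSq, mulSq_apply, kerPos, kerVel, kerVelDeriv]
    push_cast
    ring
  have e2 : -kerMoment (fun t r => -(r ^ 4 * kerVelDeriv t r) - r ^ 2 * kerVel t r) (𝓕 u₁) ψ.1 t =
      kerMoment kerVel (𝓕 u₁) ψ.mulSq.1 t + kerMoment kerVelDeriv (𝓕 u₁) ψ.mulSq.mulSq.1 t := by
    simp only [kerMoment]
    rw [← integral_add i3 i4, ← integral_neg]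
    refine integral_congr_ae (Eventually.of_forall fun x => ?_)
    simp only [BandLimited.mulSq, mulSq_apply, kerVel, kerVelDeriv]
    push_cast
    ring
  simp only [posMoment, velMoment]
  rw [sub_eq_add_neg _ (kerMoment _ _ ψ.1 t), sub_eq_add_neg _ (kerMoment _ _ ψ.1 t), e1, e2]
  simp only [BandLimited.mulSq]
  ring

/-- On functions supported in `|ξ| ≤ R`, multiplication by `|ξ|²` is bounded by `R²` in the sup
norm, so `moment_eq_zero` applies with `K = R²`. Continuity of `u` and `v` on `[0, t]` gives the
uniform bound `M`. -/
theorem posMoment_eq_zero {u₀ u₁ : L2 n} {u : ℝ → L2 n} (hu : IsSolution u₀ u₁ u) {t R : ℝ}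
    (ht : 0 ≤ t) (ψ : BandLimited n R) : posMoment u₀ u₁ u ψ.1 t = 0 := by
  obtain ⟨v, hv, huv, hv0, hweak⟩ := hu.exists_velocity
  have huc : ContinuousOn u (Set.Ici 0) := fun s hs => (huv s hs).continuousWithinAt
  obtain ⟨U, hU⟩ := isCompact_Icc.exists_bound_of_continuousOn
    (huc.mono (Set.Icc_subset_Ici_self : Set.Icc 0 t ⊆ Set.Ici 0))
  obtain ⟨V, hV⟩ := isCompact_Icc.exists_bound_of_continuousOn
    (hv.mono (Set.Icc_subset_Ici_self : Set.Icc 0 t ⊆ Set.Ici 0))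
  obtain ⟨A, hA0, hA⟩ := exists_bound_ker t R
  obtain ⟨m, hm⟩ : ∃ m, m = volume.real {x : Rn n | rad x ≤ R} := ⟨_, rfl⟩
  have hm0 : 0 ≤ m := hm ▸ measureReal_nonneg
  have hU0 : 0 ≤ U := (norm_nonneg _).trans (hU 0 ⟨le_rfl, ht⟩)
  have hV0 : 0 ≤ V := (norm_nonneg _).trans (hV 0 ⟨le_rfl, ht⟩)
  let N : BandLimited n R → ℝ → Prop := fun ψ B => 0 ≤ B ∧ ∀ x, ‖ψ.1 x‖ ≤ B
  have hL2 : ∀ (f : L2 n) (φ : BandLimited n R) (B W : ℝ), N φ B → ‖f‖ ≤ W →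
      ‖∫ x, (𝓕 f : L2 n) x * φ.1 x‖ ≤ (m + W ^ 2) * B := fun f φ B W hφ hW => by
    have := norm_integral_mul_le (𝓕 f : L2 n) (h := (𝓕 f : L2 n)) zero_le_one hφ.1
      (fun x _ => by rw [one_mul]) φ.2 hφ.2
    rw [one_mul, ← hm, Lp.norm_fourier_eq] at this
    have hB := hφ.1
    exact this.trans (by gcongr)
  have hker : ∀ (κ : ℝ → ℝ → ℝ) (f : L2 n) (φ : BandLimited n R) (B s : ℝ), N φ B →
      (∀ r, 0 ≤ r → r ≤ R → |κ s r| ≤ A) →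
      ‖kerMoment κ (𝓕 f) φ.1 s‖ ≤ A * (m + ‖f‖ ^ 2) * B := fun κ f φ B s hφ hκ => by
    have := norm_integral_mul_le (𝓕 f : L2 n) (h := fun x => (κ s (rad x) : ℂ) * (𝓕 f : L2 n) x)
      hA0 hφ.1 (fun x hx => by
        rw [norm_mul, Complex.norm_real, Real.norm_eq_abs]
        gcongr
        exact hκ _ (rad_nonneg x) hx) φ.2 hφ.2
    rwa [← hm, Lp.norm_fourier_eq] at this
  have hinit : ∀ ψ : BandLimited n R, posMoment u₀ u₁ u ψ.1 0 = 0 ∧ velMoment u₀ u₁ v ψ.1 0 = 0 := by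
    intro ψ
    rw [posMoment, velMoment, kerMoment_zero _ _ _ kerPos_zero, kerMoment_zero _ _ _ kerVel_zero,
      kerMoment_zero _ _ _ kerVelDeriv_zero, kerMoment_zero (c := 0) _ _ _ (by simp [kerVel_zero]),
      hu.initial, hv0]
    simp
  obtain ⟨B, hB⟩ : ∃ B, N ψ B := by
    obtain ⟨B, hB⟩ := ψ.1.decay 0 0
    exact ⟨B, hB.1.le, fun x => by simpa using hB.2 x⟩
  refine moment_eq_zero BandLimited.mulSq N (K := R ^ 2)
    (M := (m + U ^ 2) + (m + V ^ 2) + A * (m + ‖u₀‖ ^ 2) + A * (m + ‖u₁‖ ^ 2)) (T := t)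
    (sq_nonneg R) (by positivity) (fun φ B hφ => ⟨mul_nonneg (sq_nonneg R) hφ.1, fun x => ?_⟩)
    (fun φ B hφ => hφ.1) (fun φ => posMoment u₀ u₁ u φ.1) (fun φ => velMoment u₀ u₁ v φ.1)
    (fun φ s hs => hasDerivWithinAt_posMoment (huv s hs) φ)
    (fun φ s hs => hasDerivWithinAt_velMoment (fun χ => hweak χ s hs) φ)
    (fun φ => (hinit φ).1) (fun φ => (hinit φ).2) (fun φ B hφ s hs => ?_) hB ht
  · rcases le_or_gt (rad x) R with hx | hx
    · rw [BandLimited.mulSq, mulSq_apply, norm_mul, Complex.norm_real, Real.norm_eq_abs,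
        abs_of_nonneg (sq_nonneg _)]
      have := rad_nonneg x
      have := hφ.2 x
      gcongr
    · rw [φ.mulSq.2 x hx, norm_zero]
      exact mul_nonneg (sq_nonneg R) hφ.1
  · have hs' : |s| ≤ t := by rw [abs_of_nonneg hs.1]; exact hs.2
    have hB0 := hφ.1
    have b1 := hL2 (u s) φ B U hφ (hU s hs)
    have b2 := hL2 (v s) φ B V hφ (hV s hs)
    have b3 := hker kerPos u₀ φ B s hφ fun r h0 h1 => (hA s r hs' h0 h1).1
    have b4 := hker kerVel u₁ φ B s hφ fun r h0 h1 => (hA s r hs' h0 h1).2.1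
    have b5 := hker (fun t r => -(r ^ 2 * kerVel t r)) u₀ φ B s hφ
      fun r h0 h1 => (hA s r hs' h0 h1).2.2.2.1
    have b6 := hker kerVelDeriv u₁ φ B s hφ fun r h0 h1 => (hA s r hs' h0 h1).2.2.1
    have p1 : 0 ≤ (m + U ^ 2) * B := by positivity
    have p2 : 0 ≤ (m + V ^ 2) * B := by positivity
    constructor
    · refine (norm_sub_le _ _).trans ((add_le_add (norm_sub_le _ _) le_rfl).trans ?_)
      linarith
    · refine (norm_sub_le _ _).trans ((add_le_add (norm_sub_le _ _) le_rfl).trans ?_)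
      linarith

/-- A locally integrable function is determined by its moments against band-limited functions. -/
theorem ae_eq_zero_of_moments {f : Rn n → ℂ} (hf : LocallyIntegrable f)
    (h : ∀ (R : ℝ) (ψ : BandLimited n R), ∫ x, f x * ψ.1 x = 0) : ∀ᵐ x, f x = 0 := by
  refine ae_eq_zero_of_integral_contDiff_smul_eq_zero hf fun g hg hgc => ?_
  have hg₁ : HasCompactSupport (Complex.ofRealCLM ∘ g) := hgc.comp_left rfl
  have hg₂ : ContDiff ℝ (⊤ : ℕ∞) (Complex.ofRealCLM ∘ g) := by fun_prop
  obtain ⟨R, hR⟩ := hgc.isCompact.isBounded.subset_closedBall 0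
  have hsupp : ∀ x : Rn n, 2 * Real.pi * R < rad x → (hg₁.toSchwartzMap hg₂) x = 0 := by
    intro x hx
    have hx' : R < ‖x‖ := lt_of_mul_lt_mul_left hx (by positivity)
    have : g x = 0 := by
      by_contra hne
      have := hR (subset_tsupport g hne)
      rw [mem_closedBall_zero_iff] at this
      linarith
    simp [this]
  have := h _ ⟨hg₁.toSchwartzMap hg₂, hsupp⟩
  rw [← this]
  refine integral_congr_ae (Eventually.of_forall fun x => ?_)
  simp [mul_comm]

theorem locallyIntegrable_kernel_mul {k : ℝ → ℝ} (hm : Measurable k)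
    (hk : ∀ R : ℝ, ∃ A, ∀ r, 0 ≤ r → r ≤ R → |k r| ≤ A) (g : L2 n) :
    LocallyIntegrable fun x : Rn n => (k (rad x) : ℂ) * g x := by
  rw [locallyIntegrable_iff]
  intro K hK
  obtain ⟨R, hR⟩ := hK.isBounded.subset_closedBall 0
  obtain ⟨A, hA⟩ := hk (2 * Real.pi * R)
  have hg : IntegrableOn g K :=
    ((Lp.memLp g).locallyIntegrable one_le_two).integrableOn_isCompact hK
  refine (hg.norm.const_mul A).mono'
    (((Complex.measurable_ofReal.comp (hm.comp measurable_rad)).aestronglyMeasurable).mul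
      (Lp.aestronglyMeasurable g).restrict) ?_
  filter_upwards [ae_restrict_mem hK.measurableSet] with x hx
  have hx' := hR hx
  rw [mem_closedBall_zero_iff] at hx'
  rw [norm_mul, Complex.norm_real, Real.norm_eq_abs]
  gcongr
  refine hA _ (rad_nonneg x) ?_
  unfold rad
  gcongr

theorem quasiMeasurePreserving_scale :
    Measure.QuasiMeasurePreserving (fun ξ : Rn n => (2 * Real.pi)⁻¹ • ξ) volume volume := by
  have hπ : (2 * Real.pi)⁻¹ ≠ 0 := by positivity
  refine ⟨measurable_const_smul _, ?_⟩
  rw [Measure.map_addHaar_smul volume hπ]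
  exact Measure.smul_absolutelyContinuous

/-- The solution formula on the Fourier side. -/
theorem hat_solution {u₀ u₁ : L2 n} {u : ℝ → L2 n} (hu : IsSolution u₀ u₁ u) {t : ℝ}
    (ht : 0 ≤ t) :
    ∀ᵐ ξ : Rn n, hat (u t) ξ = kerPos t ‖ξ‖ * hat u₀ ξ + kerVel t ‖ξ‖ * hat u₁ ξ := by
  have hb : ∀ R : ℝ, ∃ A, ∀ r, 0 ≤ r → r ≤ R → |kerPos t r| ≤ A ∧ |kerVel t r| ≤ A := fun R =>
    let ⟨A, _, hA⟩ := exists_bound_ker |t| R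
    ⟨A, fun r h0 h1 => ⟨(hA t r le_rfl h0 h1).1, (hA t r le_rfl h0 h1).2.1⟩⟩
  have hae : ∀ᵐ η : Rn n, (𝓕 (u t) : L2 n) η - kerPos t (rad η) * (𝓕 u₀ : L2 n) η -
      kerVel t (rad η) * (𝓕 u₁ : L2 n) η = 0 := by
    refine ae_eq_zero_of_moments (((Lp.memLp _).locallyIntegrable one_le_two |>.sub
      (locallyIntegrable_kernel_mul (measurable_kerPos t)
        (fun R => (hb R).imp fun A hA r h0 h1 => (hA r h0 h1).1) _)).sub
      (locallyIntegrable_kernel_mul (measurable_kerVel t)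
        (fun R => (hb R).imp fun A hA r h0 h1 => (hA r h0 h1).2) _)) fun R ψ => ?_
    obtain ⟨A, hA⟩ := hb R
    have i0 := integrable_mul_schwartz (𝓕 (u t) : L2 n) ψ.1
    have i1 := integrable_kernel_mul (measurable_kerPos t) (fun r h0 h1 => (hA r h0 h1).1)
      (𝓕 u₀ : L2 n) ψ.2
    have i2 := integrable_kernel_mul (measurable_kerVel t) (fun r h0 h1 => (hA r h0 h1).2)
      (𝓕 u₁ : L2 n) ψ.2
    have := posMoment_eq_zero hu ht ψ
    simp only [sub_mul]
    exact (integral_sub (i0.sub i1) i2).trans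
      ((congrArg (· - _) (integral_sub i0 i1)).trans this)
  filter_upwards [quasiMeasurePreserving_scale.ae hae] with ξ hξ
  have hr : rad ((2 * Real.pi)⁻¹ • ξ) = ‖ξ‖ := by
    rw [rad, norm_smul, Real.norm_eq_abs, abs_of_pos (by positivity),
      mul_inv_cancel_left₀ (by positivity)]
  rw [hr] at hξ
  rw [sub_sub, sub_eq_zero] at hξ
  exact hξ

/-! ### Pointwise bounds on the transform of integrable data -/

theorem aestronglyMeasurable_hat (f : L2 n) : AEStronglyMeasurable (hat f) :=
  (Lp.aestronglyMeasurable (𝓕 f : L2 n)).comp_quasiMeasurePreserving quasiMeasurePreserving_scale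

/-- On `L¹ ∩ L²` the Fourier transform is given by the Fourier integral. -/
theorem hat_eq_integral {f : L2 n} (hf : Integrable (f : Rn n → ℂ)) :
    ∀ᵐ ξ : Rn n, hat f ξ = ∫ x : Rn n, Complex.exp (-Complex.I * (inner ℝ x ξ : ℝ)) * f x := by
  have hc : Continuous (𝓕 (f : Rn n → ℂ)) :=
    VectorFourier.fourierIntegral_continuous Real.continuous_fourierChar
      (innerSL ℝ).continuous₂ hf
  have h0 : ∀ᵐ η : Rn n, (𝓕 f : L2 n) η - 𝓕 (f : Rn n → ℂ) η = 0 := by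
    refine ae_eq_zero_of_moments
      (((Lp.memLp _).locallyIntegrable one_le_two).sub hc.locallyIntegrable) fun R ψ => ?_
    -- The integral transform and the Plancherel transform satisfy the same duality with `𝓕 ψ`,
    -- hence have equal moments.
    have h1 : ∫ ξ, 𝓕 (f : Rn n → ℂ) ξ * ψ.1 ξ = ∫ x, f x * (𝓕 ψ.1) x := by
      simpa using! VectorFourier.integral_bilin_fourierIntegral_eq_flip
        (ContinuousLinearMap.mul ℂ ℂ) (L := innerₗ (Rn n)) Real.continuous_fourierChar
        continuous_inner hf ψ.1.integrable
    have i1 : Integrable fun ξ => 𝓕 (f : Rn n → ℂ) ξ * ψ.1 ξ := by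
      refine ψ.1.integrable.bdd_mul (c := ∫ x, ‖f x‖) hc.aestronglyMeasurable
        (Eventually.of_forall fun ξ => ?_)
      exact VectorFourier.norm_fourierIntegral_le_integral_norm _ _ _ _ _
    simp only [sub_mul]
    rw [integral_sub (integrable_mul_schwartz _ ψ.1) i1, h1, integral_fourier_mul, sub_self]
  filter_upwards [quasiMeasurePreserving_scale.ae h0] with ξ hξ
  rw [hat, sub_eq_zero.1 hξ, Real.fourier_eq']
  refine integral_congr_ae (Eventually.of_forall fun x => ?_)
  have hp : (Real.pi : ℂ) ≠ 0 := by exact_mod_cast Real.pi_ne_zero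
  simp only [smul_eq_mul, inner_smul_right]
  congr 2
  push_cast
  field_simp

theorem norm_hat_le {γ : ℝ} (hγ : 0 ≤ γ) {f : L2 n} (hf : MemL1 γ f) :
    ∀ᵐ ξ : Rn n, ‖hat f ξ‖ ≤ normL1 γ f := by
  filter_upwards [hat_eq_integral hf.1] with ξ hξ
  rw [hξ]
  refine norm_integral_le_of_norm_le hf.2 (Eventually.of_forall fun x => ?_)
  have : ‖Complex.exp (-Complex.I * (inner ℝ x ξ : ℝ))‖ = 1 := by
    rw [show -Complex.I * ((inner ℝ x ξ : ℝ) : ℂ) = ((-inner ℝ x ξ : ℝ) : ℂ) * Complex.I by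
      push_cast; ring, Complex.norm_exp_ofReal_mul_I]
  rw [norm_mul, this]
  gcongr
  exact Real.one_le_rpow (by linarith [norm_nonneg x]) hγ

/-- From `|e^{-ix·ξ} - 1| ≤ |x| |ξ|`. The weight `1 + |x|` on `u₁` serves here: the gained `|ξ|`
cancels the `1/|ξ|` of the wave kernel. -/
theorem norm_hat_sub_integral_le {f : L2 n} (hf : MemL1 1 f) :
    ∀ᵐ ξ : Rn n, ‖hat f ξ - ∫ x, f x‖ ≤ ‖ξ‖ * normL1 1 f := by
  filter_upwards [hat_eq_integral hf.1] with ξ hξ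
  have hi : Integrable fun x : Rn n => Complex.exp (-Complex.I * (inner ℝ x ξ : ℝ)) * f x := by
    refine hf.1.bdd_mul (c := 1) (Continuous.aestronglyMeasurable (by fun_prop))
      (Eventually.of_forall fun x => ?_)
    rw [show -Complex.I * ((inner ℝ x ξ : ℝ) : ℂ) = ((-inner ℝ x ξ : ℝ) : ℂ) * Complex.I by
      push_cast; ring, Complex.norm_exp_ofReal_mul_I]
  rw [hξ, ← integral_sub hi hf.1, normL1, ← integral_const_mul]
  refine norm_integral_le_of_norm_le (hf.2.const_mul _) (Eventually.of_forall fun x => ?_)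
  rw [← sub_one_mul, norm_mul, Real.rpow_one, ← mul_assoc]
  gcongr
  rw [show -Complex.I * ((inner ℝ x ξ : ℝ) : ℂ) = Complex.I * ((-inner ℝ x ξ : ℝ) : ℂ) by
      push_cast; ring]
  refine Real.norm_exp_I_mul_ofReal_sub_one_le.trans ?_
  rw [norm_neg]
  calc ‖inner ℝ x ξ‖ ≤ ‖x‖ * ‖ξ‖ := norm_inner_le_norm x ξ
    _ ≤ ‖ξ‖ * (1 + ‖x‖) := by nlinarith [norm_nonneg ξ]

theorem norm_integral_le_normL1 {f : L2 n} (hf : MemL1 1 f) : ‖∫ x, f x‖ ≤ normL1 1 f := by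
  refine norm_integral_le_of_norm_le hf.2 (Eventually.of_forall fun x => ?_)
  rw [Real.rpow_one]
  nlinarith [norm_nonneg x, norm_nonneg (f x)]

/-! ### Sobolev densities and `L²` norms of radial profiles -/

/-- The integrand of the Sobolev norm, before squaring. -/
def sobolevDensity (s : ℝ) (f : L2 n) (ξ : Rn n) : ℝ := √(1 + ‖ξ‖ ^ (2 * s)) * ‖hat f ξ‖

theorem sobolevDensity_nonneg (s : ℝ) (f : L2 n) (ξ : Rn n) : 0 ≤ sobolevDensity s f ξ := by
  unfold sobolevDensity; positivity

theorem aestronglyMeasurable_sobolevDensity (s : ℝ) (f : L2 n) :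
    AEStronglyMeasurable (sobolevDensity s f) := by
  refine AEStronglyMeasurable.mul ?_ (aestronglyMeasurable_hat f).norm
  have : Measurable fun ξ : Rn n => √(1 + ‖ξ‖ ^ (2 * s)) := by fun_prop
  exact this.aestronglyMeasurable

theorem eLpNorm_sobolevDensity {s : ℝ} {f : L2 n} (hf : MemH s f) :
    eLpNorm (sobolevDensity s f) 2 volume = ENNReal.ofReal (normH s f) := by
  have h : ∀ ξ : Rn n, ‖sobolevDensity s f ξ‖ ^ 2 = (1 + ‖ξ‖ ^ (2 * s)) * ‖hat f ξ‖ ^ 2 := by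
    intro ξ
    rw [Real.norm_eq_abs, sq_abs, sobolevDensity, mul_pow, Real.sq_sqrt (by positivity)]
  rw [eLpNorm_two_eq (aestronglyMeasurable_sobolevDensity s f) (by simp only [h]; exact hf)]
  simp only [h, normH]

theorem rpow_mul_norm_hat_le {s : ℝ} (f : L2 n) (ξ : Rn n) :
    ‖ξ‖ ^ s * ‖hat f ξ‖ ≤ sobolevDensity s f ξ := by
  unfold sobolevDensity
  gcongr
  refine Real.le_sqrt_of_sq_le ?_
  rw [← Real.rpow_natCast, ← Real.rpow_mul (norm_nonneg ξ)]
  push_cast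
  rw [mul_comm s 2]
  linarith

/-- Scaling of radial `L²` norms. -/
theorem eLpNorm_radial_scale {F : ℝ → ℝ} (hF : Measurable F)
    (hi : Integrable fun x : Rn n => F ‖x‖ ^ 2) {t : ℝ} (ht : 0 < t) :
    eLpNorm (fun x : Rn n => F (t ^ (1 / 4 : ℝ) * ‖x‖)) 2 volume =
      ENNReal.ofReal (√(∫ x : Rn n, F ‖x‖ ^ 2) * t ^ (-(n : ℝ) / 8)) := by
  obtain ⟨R, hR⟩ : ∃ R, R = t ^ (1 / 4 : ℝ) := ⟨_, rfl⟩
  have hR0 : 0 < R := hR ▸ Real.rpow_pos_of_pos ht _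
  have hn : ∀ x : Rn n, F (R * ‖x‖) = (fun y : Rn n => F ‖y‖) (R • x) := fun x => by
    simp [norm_smul, abs_of_pos hR0]
  have hn2 : ∀ x : Rn n, ‖F (R * ‖x‖)‖ ^ 2 = (fun y : Rn n => F ‖y‖ ^ 2) (R • x) := fun x => by
    simp [norm_smul, abs_of_pos hR0]
  rw [← hR, eLpNorm_two_eq (Measurable.aestronglyMeasurable (by fun_prop))
    (by simpa only [hn2] using hi.comp_smul hR0.ne')]
  simp only [hn2]
  rw [Measure.integral_comp_smul_of_nonneg volume (fun y : Rn n => F ‖y‖ ^ 2) R (hR := hR0.le),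
    finrank_euclideanSpace_fin, smul_eq_mul, mul_comm, Real.sqrt_mul' _ (by positivity)]
  congr 2
  rw [hR, ← Real.rpow_natCast, ← Real.rpow_mul ht.le, ← Real.rpow_neg ht.le, Real.sqrt_eq_rpow,
    ← Real.rpow_mul ht.le]
  congr 1
  ring

theorem integrable_exp_neg_pow_four [Nontrivial (Rn n)] :
    Integrable fun x : Rn n => Real.exp (-(‖x‖ ^ 4 / 4)) ^ 2 := by
  rw [integrable_fun_norm_addHaar volume (f := fun r => Real.exp (-(r ^ 4 / 4)) ^ 2)]
  have hn : 1 ≤ n := by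
    by_contra h
    obtain rfl : n = 0 := by omega
    exact not_subsingleton (Rn 0) inferInstance
  have := integrableOn_rpow_mul_exp_neg_mul_rpow (p := 4) (s := (n : ℝ) - 1) (b := 1 / 2)
    (by have : (1 : ℝ) ≤ n := by exact_mod_cast hn
        linarith) (by norm_num) (by norm_num)
  refine this.congr_fun (fun y hy => ?_) measurableSet_Ioi
  simp only [smul_eq_mul, finrank_euclideanSpace_fin]
  rw [← Real.rpow_natCast y (n - 1), Nat.cast_sub hn, Nat.cast_one, ← Real.exp_nat_mul]
  congr 2
  rw [show (4 : ℝ) = ((4 : ℕ) : ℝ) by norm_num, Real.rpow_natCast]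
  push_cast
  ring

/-- In polar coordinates the integrand is `r^(n-3) e^{-r⁴}`, integrable at the origin because `n - 3
> -1`. -/
theorem integrable_exp_neg_pow_four_div (hn : 3 ≤ n) :
    Integrable fun x : Rn n => (Real.exp (-(‖x‖ ^ 4 / 2)) / ‖x‖) ^ 2 := by
  have : Nontrivial (Rn n) := by
    have : Nonempty (Fin n) := ⟨⟨0, by omega⟩⟩
    infer_instance
  rw [integrable_fun_norm_addHaar volume (f := fun r => (Real.exp (-(r ^ 4 / 2)) / r) ^ 2)]
  have := integrableOn_rpow_mul_exp_neg_mul_rpow (p := 4) (s := (n : ℝ) - 3) (b := 1)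
    (by have : (3 : ℝ) ≤ n := by exact_mod_cast hn
        linarith) (by norm_num) (by norm_num)
  refine this.congr_fun (fun y hy => ?_) measurableSet_Ioi
  have hy0 : (0 : ℝ) < y := hy
  simp only [smul_eq_mul, finrank_euclideanSpace_fin]
  have e1 : y ^ (n - 1) = y ^ ((n : ℝ) - 3) * y ^ 2 := by
    rw [← Real.rpow_natCast y 2, ← Real.rpow_add hy0, ← Real.rpow_natCast y (n - 1),
      Nat.cast_sub (by omega)]
    congr 1
    push_cast
    ring
  rw [e1, div_pow, ← Real.exp_nat_mul, mul_assoc, mul_div_cancel₀ _ (by positivity)]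
  congr 2
  rw [show (4 : ℝ) = ((4 : ℕ) : ℝ) by norm_num, Real.rpow_natCast]
  push_cast
  ring

theorem exists_eLpNorm_heat (hn : 1 ≤ n) : ∃ C : ℝ, 0 < C ∧ ∀ t : ℝ, 0 < t →
    eLpNorm (fun ξ : Rn n => Real.exp (-(t * ‖ξ‖ ^ 4 / 4))) 2 volume ≤
      ENNReal.ofReal (C * t ^ (-(n : ℝ) / 8)) := by
  have : Nontrivial (Rn n) := by
    have : Nonempty (Fin n) := ⟨⟨0, by omega⟩⟩
    infer_instance
  refine ⟨√(∫ x : Rn n, Real.exp (-(‖x‖ ^ 4 / 4)) ^ 2) + 1, by positivity, fun t ht => ?_⟩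
  have h := eLpNorm_radial_scale (F := fun r => Real.exp (-(r ^ 4 / 4))) (by fun_prop)
    (integrable_exp_neg_pow_four (n := n)) ht
  have e : ∀ ξ : Rn n, (t ^ (1 / 4 : ℝ) * ‖ξ‖) ^ 4 = t * ‖ξ‖ ^ 4 := fun ξ => by
    rw [mul_pow, ← Real.rpow_natCast (t ^ _) 4, ← Real.rpow_mul ht.le]
    norm_num
  simp only [e] at h
  rw [h]
  gcongr
  linarith

theorem exists_eLpNorm_wave : ∃ C : ℝ, 0 < C ∧ (3 ≤ n → ∀ t : ℝ, 0 < t →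
    eLpNorm (fun ξ : Rn n => Real.exp (-(t * ‖ξ‖ ^ 4 / 2)) / ‖ξ‖) 2 volume ≤
      ENNReal.ofReal (C * t ^ (-(n : ℝ) / 8 + 1 / 4))) := by
  refine ⟨√(∫ x : Rn n, (Real.exp (-(‖x‖ ^ 4 / 2)) / ‖x‖) ^ 2) + 1, by positivity,
    fun hn t ht => ?_⟩
  have h := eLpNorm_radial_scale (F := fun r => Real.exp (-(r ^ 4 / 2)) / r) (by fun_prop)
    (integrable_exp_neg_pow_four_div hn) ht
  obtain ⟨R, hR⟩ : ∃ R, R = t ^ (1 / 4 : ℝ) := ⟨_, rfl⟩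
  have hR0 : 0 < R := hR ▸ Real.rpow_pos_of_pos ht _
  have e : ∀ ξ : Rn n, (R * ‖ξ‖) ^ 4 = t * ‖ξ‖ ^ 4 := fun ξ => by
    rw [mul_pow, hR, ← Real.rpow_natCast (t ^ _) 4, ← Real.rpow_mul ht.le]
    norm_num
  simp only [← hR, e] at h
  -- Rescaling `1/|ξ|` releases the factor `R = t^(1/4)`, the loss relative to `t^(-n/8)`.
  have e2 : (fun ξ : Rn n => Real.exp (-(t * ‖ξ‖ ^ 4 / 2)) / ‖ξ‖) =
      R • fun ξ : Rn n => Real.exp (-(t * ‖ξ‖ ^ 4 / 2)) / (R * ‖ξ‖) := by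
    ext ξ
    simp only [Pi.smul_apply, smul_eq_mul]
    rw [mul_div_assoc', mul_div_mul_left _ _ hR0.ne']
  rw [e2, eLpNorm_const_smul, h, Real.enorm_of_nonneg hR0.le, ← ENNReal.ofReal_mul hR0.le]
  refine ENNReal.ofReal_le_ofReal ?_
  rw [Real.rpow_add ht, ← hR]
  have : 0 < t ^ (-(n : ℝ) / 8) := by positivity
  nlinarith [mul_pos hR0 this]

/-! ### The asymptotic expansion and the resulting decay -/

theorem normL1_nonneg (γ : ℝ) (f : L2 n) : 0 ≤ normL1 γ f :=
  integral_nonneg fun x => by positivity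

theorem ae_ne_zero (hn : 1 ≤ n) : ∀ᵐ ξ : Rn n, ξ ≠ 0 := by
  have : Nontrivial (Rn n) := by
    have : Nonempty (Fin n) := ⟨⟨0, by omega⟩⟩
    infer_instance
  exact Measure.ae_ne volume 0

theorem abs_waveKer_le {t r : ℝ} (hr : 0 < r) :
    |waveKer t r| ≤ Real.exp (-(t * r ^ 4 / 2)) / r := by
  rw [waveKer, abs_mul, Real.abs_exp, abs_div, abs_of_pos hr, mul_div_assoc']
  gcongr
  exact mul_le_of_le_one_right (Real.exp_pos _).le (Real.abs_sin_le_one _)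

theorem diffusionWaveProfile_eq (f : L2 n) (t : ℝ) (ξ : Rn n) :
    diffusionWaveProfile f t ξ = (∫ x, f x) * (waveKer t ‖ξ‖ : ℂ) := rfl

theorem regularityLossProfile_eq (f : L2 n) (t : ℝ) (ξ : Rn n) :
    regularityLossProfile f t ξ = (Real.exp (-(t / ‖ξ‖ ^ 2)) : ℂ) * hat f ξ := rfl

/-- Pointwise form of the main asymptotic expansion. -/
theorem exists_pointwise_expansion (hn : 1 ≤ n) {l : ℝ} (hl : 0 ≤ l) :
    ∃ C : ℝ, 0 < C ∧ ∀ (u₀ u₁ : L2 n) (u : ℝ → L2 n), MemL1 0 u₀ → MemL1 1 u₁ →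
      IsSolution u₀ u₁ u → ∀ t : ℝ, 1 ≤ t → ∀ᵐ ξ : Rn n,
        ‖hat (u t) ξ - diffusionWaveProfile u₁ t ξ - regularityLossProfile u₀ t ξ‖ ≤
          7 * (normL1 0 u₀ + normL1 1 u₁) * Real.exp (-(t * ‖ξ‖ ^ 4 / 4)) +
          C * t ^ (-((l + 4) / 2)) * (sobolevDensity (l + 1) u₀ ξ + sobolevDensity l u₁ ξ) := by
  obtain ⟨C, hC, hker⟩ := exists_ker_decay hl
  refine ⟨C, hC, fun u₀ u₁ u h0 h1 hu t ht => ?_⟩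
  have ht0 : 0 ≤ t := by linarith
  filter_upwards [hat_solution hu ht0, norm_hat_le le_rfl h0, norm_hat_le zero_le_one h1,
    norm_hat_sub_integral_le h1, ae_ne_zero hn] with ξ hs hu0 hu1 hd hξ
  have hr : 0 < ‖ξ‖ := norm_pos_iff.2 hξ
  have hP := norm_integral_le_normL1 h1
  have n0 := normL1_nonneg 0 u₀
  have n1 := normL1_nonneg 1 u₁
  have s0 := sobolevDensity_nonneg (l + 1) u₀ ξ
  have s1 := sobolevDensity_nonneg l u₁ ξ
  rw [hs, diffusionWaveProfile_eq, regularityLossProfile_eq]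
  have w0 := rpow_mul_norm_hat_le (s := l + 1) u₀ ξ
  have w1 := rpow_mul_norm_hat_le (s := l) u₁ ξ
  have hwave := abs_waveKer_le (t := t) hr
  generalize ‖ξ‖ = r at *
  obtain ⟨E, hE⟩ : ∃ E, E = Real.exp (-(t * r ^ 4 / 4)) := ⟨_, rfl⟩
  have hE0 : 0 < E := hE ▸ Real.exp_pos _
  have htr : 0 ≤ t * r ^ 4 := by positivity
  have hE2 : Real.exp (-(t * r ^ 4 / 2)) ≤ E := by
    rw [hE]; gcongr; norm_num
  have htm : 0 < t ^ (-((l + 4) / 2)) := Real.rpow_pos_of_pos (by linarith) _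
  rw [← hE]
  rcases le_total r 1 with h | h
  · have k0 := abs_kerPos_low ht0 hr h
    have k1 := abs_kerVel_sub_waveKer_low ht0 hr h
    rw [← hE] at k0 k1
    -- At low frequency the regularity-loss profile is itself an error term, since `r⁴/4 ≤ 1/r²` for
    -- `r ≤ 1`.
    have hG : Real.exp (-(t / r ^ 2)) ≤ E := by
      rw [hE]
      refine Real.exp_le_exp.2 (neg_le_neg ?_)
      rw [div_le_div_iff₀ (by norm_num) (by positivity)]
      have : r ^ 4 * r ^ 2 ≤ 1 := by
        rw [← pow_add]; exact pow_le_one₀ hr.le h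
      nlinarith
    have e : (kerPos t r : ℂ) * hat u₀ ξ + kerVel t r * hat u₁ ξ - (∫ x, u₁ x) * (waveKer t r : ℂ)
        - (Real.exp (-(t / r ^ 2)) : ℂ) * hat u₀ ξ =
        ((kerPos t r : ℂ) * hat u₀ ξ - (Real.exp (-(t / r ^ 2)) : ℂ) * hat u₀ ξ) +
        (((kerVel t r - waveKer t r : ℝ) : ℂ) * hat u₁ ξ +
        (waveKer t r : ℂ) * (hat u₁ ξ - ∫ x, u₁ x)) := by
      push_cast; ring
    rw [e]
    have b1 : ‖(kerPos t r : ℂ) * hat u₀ ξ - (Real.exp (-(t / r ^ 2)) : ℂ) * hat u₀ ξ‖ ≤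
        3 * E * normL1 0 u₀ := by
      refine (norm_sub_le _ _).trans ?_
      rw [norm_mul, norm_mul, Complex.norm_real, Complex.norm_real, Real.norm_eq_abs,
        Real.norm_eq_abs, Real.abs_exp]
      calc _ ≤ 2 * E * normL1 0 u₀ + E * normL1 0 u₀ := by gcongr
        _ = _ := by ring
    have b2 : ‖((kerVel t r - waveKer t r : ℝ) : ℂ) * hat u₁ ξ‖ ≤ 3 * E * normL1 1 u₁ := by
      rw [norm_mul, Complex.norm_real, Real.norm_eq_abs]
      gcongr
    have b3 : ‖(waveKer t r : ℂ) * (hat u₁ ξ - ∫ x, u₁ x)‖ ≤ E * normL1 1 u₁ := by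
      rw [norm_mul, Complex.norm_real, Real.norm_eq_abs]
      calc _ ≤ E / r * (r * normL1 1 u₁) := by
            gcongr
            exact hwave.trans (by gcongr)
        _ = _ := by field_simp
    refine (norm_add_le _ _).trans ((add_le_add b1 ((norm_add_le _ _).trans
      (add_le_add b2 b3))).trans ?_)
    have : 0 ≤ C * t ^ (-((l + 4) / 2)) * (sobolevDensity (l + 1) u₀ ξ + sobolevDensity l u₁ ξ) := by
      positivity
    -- The low-frequency coefficients are `3` for `u₀` and `3 + 1` for `u₁`, both below `7`.
    nlinarith [mul_nonneg hE0.le n0, mul_nonneg hE0.le n1]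
  · obtain ⟨k0, k1⟩ := hker t r ht h
    have e : (kerPos t r : ℂ) * hat u₀ ξ + kerVel t r * hat u₁ ξ - (∫ x, u₁ x) * (waveKer t r : ℂ)
        - (Real.exp (-(t / r ^ 2)) : ℂ) * hat u₀ ξ =
        ((kerPos t r - Real.exp (-(t / r ^ 2)) : ℝ) : ℂ) * hat u₀ ξ +
        ((kerVel t r : ℂ) * hat u₁ ξ - (∫ x, u₁ x) * (waveKer t r : ℂ)) := by
      push_cast; ring
    rw [e]
    have b1 : ‖((kerPos t r - Real.exp (-(t / r ^ 2)) : ℝ) : ℂ) * hat u₀ ξ‖ ≤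
        C * t ^ (-((l + 4) / 2)) * sobolevDensity (l + 1) u₀ ξ := by
      rw [norm_mul, Complex.norm_real, Real.norm_eq_abs]
      calc _ ≤ C * t ^ (-((l + 4) / 2)) * r ^ (l + 1) * ‖hat u₀ ξ‖ := by gcongr
        _ = C * t ^ (-((l + 4) / 2)) * (r ^ (l + 1) * ‖hat u₀ ξ‖) := by ring
        _ ≤ _ := by gcongr
    have b2 : ‖(kerVel t r : ℂ) * hat u₁ ξ‖ ≤
        C * t ^ (-((l + 4) / 2)) * sobolevDensity l u₁ ξ := by
      rw [norm_mul, Complex.norm_real, Real.norm_eq_abs]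
      calc _ ≤ C * t ^ (-((l + 4) / 2)) * r ^ l * ‖hat u₁ ξ‖ := by gcongr
        _ = C * t ^ (-((l + 4) / 2)) * (r ^ l * ‖hat u₁ ξ‖) := by ring
        _ ≤ _ := by gcongr
    -- Away from the origin the wave profile is not matched with the solution; its damping alone
    -- makes it negligible.
    have b3 : ‖(∫ x, u₁ x) * (waveKer t r : ℂ)‖ ≤ normL1 1 u₁ * E := by
      rw [norm_mul, Complex.norm_real, Real.norm_eq_abs]
      gcongr
      exact hwave.trans ((div_le_self (Real.exp_pos _).le h).trans hE2)
    refine (norm_add_le _ _).trans ((add_le_add b1 ((norm_sub_le _ _).trans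
      (add_le_add b2 b3))).trans ?_)
    nlinarith [mul_nonneg hE0.le n0, mul_nonneg hE0.le n1]

/-- The bound `e^{-x} ≤ m^m x^{-m}` with `x = t/|ξ|²` and `m = s/2` charges exactly `|ξ|^s` to the
data. -/
theorem exists_regularityLossProfile_le (hn : 1 ≤ n) {s : ℝ} (hs : 0 < s) :
    ∃ C : ℝ, 0 < C ∧ ∀ (f : L2 n) (t : ℝ), 0 < t → ∀ᵐ ξ : Rn n,
      ‖regularityLossProfile f t ξ‖ ≤ C * t ^ (-(s / 2)) * sobolevDensity s f ξ := by
  have hm : 0 < s / 2 := by linarith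
  refine ⟨(s / 2) ^ (s / 2), by positivity, fun f t ht => ?_⟩
  filter_upwards [ae_ne_zero hn] with ξ hξ
  have hr : 0 < ‖ξ‖ := norm_pos_iff.2 hξ
  have h := exp_neg_le_rpow hm (show 0 < t / ‖ξ‖ ^ 2 by positivity)
  rw [Real.div_rpow ht.le (by positivity), Real.rpow_neg (by positivity : 0 ≤ ‖ξ‖ ^ 2),
    div_inv_eq_mul, ← Real.rpow_natCast ‖ξ‖ 2, ← Real.rpow_mul hr.le,
    show ((2 : ℕ) : ℝ) * (s / 2) = s by push_cast; ring, Real.rpow_natCast] at h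
  rw [regularityLossProfile_eq, norm_mul, Complex.norm_real, Real.norm_eq_abs, Real.abs_exp]
  calc _ ≤ (s / 2) ^ (s / 2) * (t ^ (-(s / 2)) * ‖ξ‖ ^ s) * ‖hat f ξ‖ := by gcongr
    _ = (s / 2) ^ (s / 2) * t ^ (-(s / 2)) * (‖ξ‖ ^ s * ‖hat f ξ‖) := by ring
    _ ≤ _ := by
      gcongr
      exact rpow_mul_norm_hat_le f ξ

theorem norm_diffusionWaveProfile_le (hn : 1 ≤ n) {f : L2 n} (hf : MemL1 1 f) (t : ℝ) :
    ∀ᵐ ξ : Rn n, ‖diffusionWaveProfile f t ξ‖ ≤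
      normL1 1 f * (Real.exp (-(t * ‖ξ‖ ^ 4 / 2)) / ‖ξ‖) := by
  filter_upwards [ae_ne_zero hn] with ξ hξ
  rw [diffusionWaveProfile_eq, norm_mul, Complex.norm_real, Real.norm_eq_abs]
  have := normL1_nonneg 1 f
  gcongr
  · exact norm_integral_le_normL1 hf
  · exact abs_waveKer_le (norm_pos_iff.2 hξ)

theorem eLpNorm_add_le_ofReal {f g : Rn n → ℝ} {a b : ℝ} (hf : AEStronglyMeasurable f)
    (hg : AEStronglyMeasurable g) (ha : 0 ≤ a) (hb : 0 ≤ b)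
    (hfa : eLpNorm f 2 volume ≤ ENNReal.ofReal a) (hgb : eLpNorm g 2 volume ≤ ENNReal.ofReal b) :
    eLpNorm (fun x => f x + g x) 2 volume ≤ ENNReal.ofReal (a + b) := by
  rw [ENNReal.ofReal_add ha hb]
  exact (eLpNorm_add_le hf hg one_le_two).trans (add_le_add hfa hgb)

theorem eLpNorm_const_mul_le_ofReal {f : Rn n → ℝ} {a c : ℝ} (hc : 0 ≤ c)
    (hfa : eLpNorm f 2 volume ≤ ENNReal.ofReal a) :
    eLpNorm (fun x => c * f x) 2 volume ≤ ENNReal.ofReal (c * a) := by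
  have := eLpNorm_const_smul c f 2 volume
  rw [show (fun x => c * f x) = c • f from rfl, this, Real.enorm_of_nonneg hc,
    ENNReal.ofReal_mul hc]
  gcongr

/-- The three basic estimates from which all decay rates follow. -/
theorem exists_decay (hn : 1 ≤ n) {l : ℝ} (hl : 0 ≤ l) :
    ∃ C : ℝ, 0 < C ∧ ∀ (u₀ u₁ : L2 n) (u : ℝ → L2 n),
      MemH (l + 1) u₀ → MemL1 0 u₀ → MemH l u₁ → MemL1 1 u₁ → IsSolution u₀ u₁ u →
      ∀ t : ℝ, 1 ≤ t → 0 ≤ dataNorm l 0 u₀ u₁ ∧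
        eLpNorm (fun ξ : Rn n => hat (u t) ξ - diffusionWaveProfile u₁ t ξ
            - regularityLossProfile u₀ t ξ) 2 volume ≤
          ENNReal.ofReal (C * dataNorm l 0 u₀ u₁ * (t ^ (-(n : ℝ) / 8) + t ^ (-((l + 4) / 2)))) ∧
        (3 ≤ n → eLpNorm (fun ξ : Rn n => hat (u t) ξ - regularityLossProfile u₀ t ξ) 2 volume ≤
          ENNReal.ofReal (C * dataNorm l 0 u₀ u₁ *
            (t ^ (-(n : ℝ) / 8) + t ^ (-((l + 4) / 2)) + t ^ (-(n : ℝ) / 8 + 1 / 4)))) ∧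
        eLpNorm (fun ξ : Rn n => hat (u t) ξ - diffusionWaveProfile u₁ t ξ) 2 volume ≤
          ENNReal.ofReal (C * dataNorm l 0 u₀ u₁ *
            (t ^ (-(n : ℝ) / 8) + t ^ (-((l + 4) / 2)) + t ^ (-((l + 1) / 2)))) := by
  obtain ⟨C₁, hC₁, hexp⟩ := exists_pointwise_expansion hn hl
  obtain ⟨C₂, hC₂, hrl⟩ := exists_regularityLossProfile_le hn (show 0 < l + 1 by linarith)
  obtain ⟨C₃, hC₃, hheat⟩ := exists_eLpNorm_heat hn
  obtain ⟨C₄, hC₄, hwave⟩ := exists_eLpNorm_wave (n := n)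
  refine ⟨7 * C₃ + C₁ + C₂ + C₄, by positivity,
    fun u₀ u₁ u hH0 hL0 hH1 hL1 hu t ht => ?_⟩
  have ht0 : 0 < t := by linarith
  obtain ⟨I, hI⟩ : ∃ I, I = dataNorm l 0 u₀ u₁ := ⟨_, rfl⟩
  have hH0' : 0 ≤ normH (l + 1) u₀ := Real.sqrt_nonneg _
  have hH1' : 0 ≤ normH l u₁ := Real.sqrt_nonneg _
  have n0 := normL1_nonneg 0 u₀
  have n1 := normL1_nonneg 1 u₁
  have hIeq : I = normH (l + 1) u₀ + normH l u₁ + normL1 0 u₀ + normL1 1 u₁ := by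
    rw [hI, dataNorm, zero_add]
  have hI0 : 0 ≤ I := by rw [hIeq]; positivity
  rw [← hI]
  obtain ⟨a, ha⟩ : ∃ a, a = t ^ (-(n : ℝ) / 8) := ⟨_, rfl⟩
  obtain ⟨b, hb⟩ : ∃ b, b = t ^ (-((l + 4) / 2)) := ⟨_, rfl⟩
  obtain ⟨c, hc⟩ : ∃ c, c = t ^ (-((l + 1) / 2)) := ⟨_, rfl⟩
  obtain ⟨d, hd⟩ : ∃ d, d = t ^ (-(n : ℝ) / 8 + 1 / 4) := ⟨_, rfl⟩
  rw [← ha, ← hb, ← hc, ← hd]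
  have ha0 : 0 < a := ha ▸ Real.rpow_pos_of_pos ht0 _
  have hb0 : 0 < b := hb ▸ Real.rpow_pos_of_pos ht0 _
  have hc0 : 0 < c := hc ▸ Real.rpow_pos_of_pos ht0 _
  have hd0 : 0 < d := hd ▸ Real.rpow_pos_of_pos ht0 _
  have hX := hexp u₀ u₁ u hL0 hL1 hu t ht
  have hR := hrl u₀ t ht0
  have hD := norm_diffusionWaveProfile_le hn hL1 t
  have hh := hheat t ht0
  rw [← ha] at hh
  rw [← hb] at hX
  rw [← hc] at hR
  have mS0 := aestronglyMeasurable_sobolevDensity (l + 1) u₀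
  have mS1 := aestronglyMeasurable_sobolevDensity l u₁
  have mE : AEStronglyMeasurable (fun ξ : Rn n => Real.exp (-(t * ‖ξ‖ ^ 4 / 4))) :=
    Measurable.aestronglyMeasurable (by fun_prop)
  have mW : AEStronglyMeasurable (fun ξ : Rn n => Real.exp (-(t * ‖ξ‖ ^ 4 / 2)) / ‖ξ‖) :=
    Measurable.aestronglyMeasurable (by fun_prop)
  have hS := eLpNorm_add_le_ofReal mS0 mS1 hH0' hH1' (eLpNorm_sobolevDensity hH0).le
    (eLpNorm_sobolevDensity hH1).le
  have hmain := eLpNorm_add_le_ofReal (mE.const_mul (7 * (normL1 0 u₀ + normL1 1 u₁)))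
    ((mS0.add mS1).const_mul (C₁ * b)) (by positivity) (by positivity)
    (eLpNorm_const_mul_le_ofReal (by positivity) hh)
    (eLpNorm_const_mul_le_ofReal (by positivity) hS)
  have mmain := (mE.const_mul (7 * (normL1 0 u₀ + normL1 1 u₁))).add
    ((mS0.add mS1).const_mul (C₁ * b))
  have r1 : 7 * (normL1 0 u₀ + normL1 1 u₁) * (C₃ * a) ≤ 7 * C₃ * I * a := by
    calc _ ≤ 7 * I * (C₃ * a) := by gcongr; linarith
      _ = _ := by ring
  have r2 : C₁ * b * (normH (l + 1) u₀ + normH l u₁) ≤ C₁ * I * b := by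
    calc _ ≤ C₁ * b * I := by gcongr; linarith
      _ = _ := by ring
  -- Merging the four constants into their sum leaves surplus terms of this form, discarded by
  -- `linarith` below.
  have p : ∀ C x : ℝ, 0 ≤ C → 0 < x → 0 ≤ C * I * x := fun C x h h' => by positivity
  have pa1 := p C₁ a hC₁.le ha0
  have pa2 := p C₂ a hC₂.le ha0
  have pa4 := p C₄ a hC₄.le ha0
  have pb3 := p C₃ b hC₃.le hb0
  have pb2 := p C₂ b hC₂.le hb0
  have pb4 := p C₄ b hC₄.le hb0
  refine ⟨hI0, ?_, fun hn3 => ?_, ?_⟩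
  · refine (eLpNorm_mono_ae_real hX).trans (hmain.trans (ENNReal.ofReal_le_ofReal ?_))
    linarith
  · have hw := hwave hn3 t ht0
    rw [← hd] at hw
    have := eLpNorm_add_le_ofReal mmain (mW.const_mul (normL1 1 u₁)) (by positivity)
      (by positivity) hmain (eLpNorm_const_mul_le_ofReal n1 hw)
    refine (eLpNorm_mono_ae_real ?_).trans (this.trans (ENNReal.ofReal_le_ofReal ?_))
    · filter_upwards [hX, hD] with ξ h1 h2
      rw [show hat (u t) ξ - regularityLossProfile u₀ t ξ = (hat (u t) ξ -
        diffusionWaveProfile u₁ t ξ - regularityLossProfile u₀ t ξ) +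
        diffusionWaveProfile u₁ t ξ by ring]
      exact (norm_add_le _ _).trans (add_le_add h1 h2)
    · have r3 : normL1 1 u₁ * (C₄ * d) ≤ C₄ * I * d := by
        calc _ ≤ I * (C₄ * d) := by gcongr; linarith
          _ = _ := by ring
      have pd1 := p C₁ d hC₁.le hd0
      have pd2 := p C₂ d hC₂.le hd0
      have pd3 := p C₃ d hC₃.le hd0
      linarith
  · have := eLpNorm_add_le_ofReal mmain (mS0.const_mul (C₂ * c)) (by positivity)
      (by positivity) hmain
      (eLpNorm_const_mul_le_ofReal (by positivity) (eLpNorm_sobolevDensity hH0).le)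
    refine (eLpNorm_mono_ae_real ?_).trans (this.trans (ENNReal.ofReal_le_ofReal ?_))
    · filter_upwards [hX, hR] with ξ h1 h2
      rw [show hat (u t) ξ - diffusionWaveProfile u₁ t ξ = (hat (u t) ξ -
        diffusionWaveProfile u₁ t ξ - regularityLossProfile u₀ t ξ) +
        regularityLossProfile u₀ t ξ by ring]
      exact (norm_add_le _ _).trans (add_le_add h1 h2)
    · have r3 : C₂ * c * normH (l + 1) u₀ ≤ C₂ * I * c := by
        calc _ ≤ C₂ * c * I := by gcongr; linarith
          _ = _ := by ring
      have pc1 := p C₁ c hC₁.le hc0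
      have pc3 := p C₃ c hC₃.le hc0
      have pc4 := p C₄ c hC₄.le hc0
      linarith

end DampedWave

end

theorem theorem4p7 (n : ℕ) (hn : 1 ≤ n) (l : ℝ) (hl : 0 ≤ l) :
    ∃ C : ℝ, 0 < C ∧
      ∀ (u₀ u₁ : L2 n) (u : ℝ → L2 n),
        MemH (l + 1) u₀ → MemL1 0 u₀ → MemH l u₁ → MemL1 1 u₁ → IsSolution u₀ u₁ u →
        ∀ t : ℝ, 1 ≤ t →
          -- (i)
          ((18 ≤ n ∧ 0 ≤ l ∧ l ≤ (n : ℝ) / 4 - 9 / 2 →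
              eLpNorm (fun ξ : Rn n => hat (u t) ξ - regularityLossProfile u₀ t ξ) 2 volume
                ≤ ENNReal.ofReal (C * dataNorm l 0 u₀ u₁ * t ^ (-((l + 4) / 2)))) ∧
            ((18 ≤ n ∧ (n : ℝ) / 4 - 9 / 2 < l ∧ l < (n : ℝ) / 4 - 3 / 2) ∨
                (7 ≤ n ∧ n ≤ 17 ∧ 0 ≤ l ∧ l < (n : ℝ) / 4 - 3 / 2) →
              eLpNorm (fun ξ : Rn n => hat (u t) ξ - regularityLossProfile u₀ t ξ) 2 volume
                ≤ ENNReal.ofReal (C * dataNorm l 0 u₀ u₁ * t ^ (-(n : ℝ) / 8 + 1 / 4)))) ∧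
          -- (ii)
          (6 ≤ n ∧ l = (n : ℝ) / 4 - 3 / 2 →
            eLpNorm (fun ξ : Rn n => hat (u t) ξ - diffusionWaveProfile u₁ t ξ
                - regularityLossProfile u₀ t ξ) 2 volume
              ≤ ENNReal.ofReal (C * dataNorm l 0 u₀ u₁ * t ^ (-(n : ℝ) / 8))) ∧
          -- (iii)
          ((((6 ≤ n ∧ (n : ℝ) / 4 - 3 / 2 < l ∧ l ≤ (n : ℝ) / 4 - 1) ∨
                ((n = 4 ∨ n = 5) ∧ 0 ≤ l ∧ l ≤ (n : ℝ) / 4 - 1)) →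
              eLpNorm (fun ξ : Rn n => hat (u t) ξ - diffusionWaveProfile u₁ t ξ) 2 volume
                ≤ ENNReal.ofReal (C * dataNorm l 0 u₀ u₁ * t ^ (-((l + 1) / 2)))) ∧
            (((4 ≤ n ∧ (n : ℝ) / 4 - 1 < l) ∨ ((n = 1 ∨ n = 2 ∨ n = 3) ∧ 0 ≤ l)) →
              eLpNorm (fun ξ : Rn n => hat (u t) ξ - diffusionWaveProfile u₁ t ξ) 2 volume
                ≤ ENNReal.ofReal (C * dataNorm l 0 u₀ u₁ * t ^ (-(n : ℝ) / 8)))) := by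
  obtain ⟨C, hC, h⟩ := exists_decay hn hl
  -- At most three powers of `t` occur in each estimate, and as `t ≥ 1` each is bounded by the one
  -- with the largest exponent; hence the factor `3`.
  refine ⟨3 * C, by positivity, fun u₀ u₁ u hH0 hL0 hH1 hL1 hu t ht => ?_⟩
  obtain ⟨hI, h1, h2, h3⟩ := h u₀ u₁ u hH0 hL0 hH1 hL1 hu t ht
  have hp : ∀ {x y : ℝ}, x ≤ y → t ^ x ≤ t ^ y := fun hxy => Real.rpow_le_rpow_of_exponent_le ht hxy
  have h0 : ∀ x : ℝ, 0 ≤ t ^ x := fun x => Real.rpow_nonneg (by linarith) x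
  have fin : ∀ {A : ℝ≥0∞} {X Y : ℝ}, A ≤ ENNReal.ofReal (C * dataNorm l 0 u₀ u₁ * X) →
      X ≤ 3 * Y → A ≤ ENNReal.ofReal (3 * C * dataNorm l 0 u₀ u₁ * Y) := fun hA hXY =>
    hA.trans (ENNReal.ofReal_le_ofReal (by
      calc _ ≤ C * dataNorm l 0 u₀ u₁ * (3 * _) := by gcongr
        _ = _ := by ring))
  refine ⟨⟨?_, ?_⟩, ?_, ?_, ?_⟩
  -- The threshold `l = n/4 - 9/2` is where `(l+4)/2 = n/8 - 1/4`: below it regularity loss is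
  -- slower than the wave profile.
  · rintro ⟨hn18, -, hl2⟩
    have e1 := hp (show -(n : ℝ) / 8 ≤ -((l + 4) / 2) by linarith)
    have e2 := hp (show -(n : ℝ) / 8 + 1 / 4 ≤ -((l + 4) / 2) by linarith)
    exact fin (h2 (by omega)) (by linarith)
  · intro hcase
    have hn3 : 3 ≤ n := by rcases hcase with hcase | hcase <;> omega
    have hl2 : (n : ℝ) / 4 - 9 / 2 ≤ l := by
      rcases hcase with ⟨-, hcase, -⟩ | ⟨-, hn17, -⟩
      · exact hcase.le
      -- For `n ≤ 17` the threshold `n/4 - 9/2` is negative, so every `l ≥ 0` lies above it.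
      · have : (n : ℝ) ≤ 17 := by exact_mod_cast hn17
        linarith
    have e1 := hp (show -(n : ℝ) / 8 ≤ -(n : ℝ) / 8 + 1 / 4 by linarith)
    have e2 := hp (show -((l + 4) / 2) ≤ -(n : ℝ) / 8 + 1 / 4 by linarith)
    exact fin (h2 hn3) (by linarith)
  · rintro ⟨-, hl2⟩
    have e1 := hp (show -((l + 4) / 2) ≤ -(n : ℝ) / 8 by linarith)
    have e2 := h0 (-(n : ℝ) / 8)
    exact fin h1 (by linarith)
  · intro hcase
    -- The threshold `l = n/4 - 1` is where `(l+1)/2 = n/8`; it separates the two rates in (iii).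
    have hl2 : l ≤ (n : ℝ) / 4 - 1 := by
      rcases hcase with hcase | hcase
      · exact hcase.2.2
      · exact hcase.2.2
    have e1 := hp (show -(n : ℝ) / 8 ≤ -((l + 1) / 2) by linarith)
    have e2 := hp (show -((l + 4) / 2) ≤ -((l + 1) / 2) by linarith)
    exact fin h3 (by linarith)
  · intro hcase
    have hl2 : (n : ℝ) / 4 - 1 ≤ l := by
      rcases hcase with hcase | ⟨hn3, -⟩
      · exact hcase.2.le
      · have : (n : ℝ) ≤ 3 := by exact_mod_cast (show n ≤ 3 by omega)
        linarith
    have e1 := hp (show -((l + 1) / 2) ≤ -(n : ℝ) / 8 by linarith)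
    have e2 := hp (show -((l + 4) / 2) ≤ -(n : ℝ) / 8 by linarith)
    exact fin h3 (by linarith)
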